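/- **Conventions.** A lattice polytope in $\mathbb R^D$ is the convex hull of a nonempty finite subset of $\mathbb Z^D$. Let $K$ be a field. For a lattice polytope $\mathcal P\subset\mathbb R^D$ the toric ideal $I_{\mathcal P}$ is the kernel of the $K$-algebra homomorphism $K[x_{\mathbf a}:\mathbf a\in\mathcal P\cap\mathbb Z^D]\to K[t_1^{\pm1},\dots,t_D^{\pm1},s]$, $x_{\mathbf a}\mapsto \mathbf t^{\mathbf a}s$. An ideal $I$ of a polynomial ring over $K$ *possesses a squarefree initial ideal of degree at most $\ell$* if, for some monomial order, the initial ideal of $I$ (generated by the leading terms of the elements of $I$) is generated by squarefree monomials of degree at most $\ell$. The polytope $\mathcal P$ is *IDP* if $(\mathcal P\cap\mathbb Z^D)+(k\mathcal P\cap\mathbb Z^D)=(k+1)\mathcal P\cap\mathbb Z^D$ for every integer $k\ge1$. A *regular unimodular triangulation* of $\mathcal P$ is a triangulation of $\mathcal P$ with vertices in $\mathcal P\cap\mathbb Z^D$ which is induced by a height function on $\mathcal P\cap\mathbb Z^D$ (its simplices are the projections of the lower faces of the convex hull of the lifted points) and all of whose simplices are unimodular (for each simplex with vertex set $S$, every lattice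 point of the affine hull of $S$ is an integer affine combination of the points of $S$). For $m\ge2$ and $\mathcal P_1,\dots,\mathcal P_m\subset\mathbb R^d$, the *Cayley sum* $\mathcal P_1*\cdots*\mathcal P_m\subset\mathbb R^{d+m-1}$ is the convex hull of $(\mathcal P_1\times\{\mathbf e_1\})\cup\dots\cup(\mathcal P_{m-1}\times\{\mathbf e_{m-1}\})\cup(\mathcal P_m\times\{\mathbf 0\})$, where $\mathbf e_1,\dots,\mathbf e_{m-1}$ are the unit vectors of $\mathbb R^{m-1}$, and $\mathcal P_1+\dots+\mathcal P_m$ is the Minkowski sum. **Theorem.** Let $m\ge2$, let $\mathcal P_1,\dots,\mathcal P_m\subset\mathbb R^d$ be lattice polytopes of dimension $d$, and suppose that for every $i$ $$\sum_{\mathbf a\in\mathcal P_i\cap\mathbb Z^d}\mathbb Z(\mathbf a,1)=\mathbb Z^{d+1}.$$ Let $\ell$ be a nonnegative integer. If the toric ideal $I_{\mathcal P_1*\cdots*\mathcal P_m}$ possesses a squarefree initial ideal of degree at most $\ell$, then the toric ideal $I_{\mathcal P_1+\cdots+\mathcal P_m}$ possesses a squarefree initial ideal of degree at most $\ell$. Moreover,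 both $\mathcal P_1*\cdots*\mathcal P_m$ and $\mathcal P_1+\cdots+\mathcal P_m$ then have a regular unimodular triangulation and are IDP. -/

import Mathlib

open scoped Pointwise

namespace CayleyMinkowski

noncomputable section

/-- The inclusion of the lattice `ℤ^ι` into `ℝ^ι`. -/
def toReal {ι : Type} (a : ι → ℤ) : ι → ℝ := fun i => (a i : ℝ)

/-- A lattice polytope in `ℝ^ι`: the convex hull of a nonempty finite set of points of `ℤ^ι`. -/
def IsLatticePolytope {ι : Type} (P : Set (ι → ℝ)) : Prop :=
  ∃ V : Finset (ι → ℤ), V.Nonempty ∧ P = convexHull ℝ (toReal '' (V : Set (ι → ℤ)))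

/-- The dimension of (the affine hull of) a nonempty set `P ⊆ ℝ^ι`. -/
def dim {ι : Type} (P : Set (ι → ℝ)) : ℕ := Module.finrank ℝ (vectorSpan ℝ P)

/-- The set of lattice points `P ∩ ℤ^ι`. -/
def latticePoints {ι : Type} (P : Set (ι → ℝ)) : Set (ι → ℤ) := {a | toReal a ∈ P}

/-- The subgroup of `ℤ^ι × ℤ` generated by the points `(a, 1)`, `a ∈ P ∩ ℤ^ι`. -/
def liftedLattice {ι : Type} (P : Set (ι → ℝ)) : AddSubgroup ((ι → ℤ) × ℤ) :=
  AddSubgroup.closure ((fun a => (a, (1 : ℤ))) '' latticePoints P)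

/-- The Cayley sum of `P_0, …, P_{m-1} ⊆ ℝ^d` inside `ℝ^d × ℝ^{m-1}`: the convex hull of the union
of the sets `P_i × {e_i}` for `i < m - 1` and `P_{m-1} × {0}`.  (For `i = m - 1` the second block
of coordinates in the formula below is `0`, since its index `j` is always less than `m - 1`.) -/
def cayleySum {d m : ℕ} (P : Fin m → Set (Fin d → ℝ)) : Set (Fin d ⊕ Fin (m - 1) → ℝ) :=
  convexHull ℝ (⋃ i : Fin m,
    (fun x : Fin d → ℝ =>
      Sum.elim x (fun j : Fin (m - 1) => if (j : ℕ) = (i : ℕ) then (1 : ℝ) else 0)) '' P i)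

/-- The integer decomposition property:
`P ∩ ℤ^ι + kP ∩ ℤ^ι = (k+1)P ∩ ℤ^ι` for every integer `k ≥ 1`. -/
def IsIDP {ι : Type} (P : Set (ι → ℝ)) : Prop :=
  ∀ k : ℕ, 1 ≤ k →
    latticePoints P + latticePoints ((k : ℝ) • P) = latticePoints (((k : ℝ) + 1) • P)

/-- The `K`-algebra homomorphism from `K[x_a : a ∈ P ∩ ℤ^ι]` to `K[t_i^{±1} (i ∈ ι), s]`
with `x_a ↦ t^a s`.  The target is the monoid algebra of `ℤ^ι × ℕ`, in which `t^a s^n` is the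
basis element of `(a, n)`.  The image of this map is the toric ring of `P`. -/
def toricMap (K : Type*) [Field K] {ι : Type} (P : Set (ι → ℝ)) :
    MvPolynomial (latticePoints P) K →ₐ[K] AddMonoidAlgebra K ((ι → ℤ) × ℕ) :=
  MvPolynomial.aeval (fun a : latticePoints P => AddMonoidAlgebra.single ((a : ι → ℤ), 1) (1 : K))

/-- The toric ideal of `P`. -/
def toricIdeal (K : Type*) [Field K] {ι : Type} (P : Set (ι → ℝ)) :
    Ideal (MvPolynomial (latticePoints P) K) :=
  RingHom.ker (toricMap K P)

/-- The initial ideal of `I` with respect to a monomial order: the ideal generated by the leading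
terms of the elements of `I`. -/
def initialIdeal {K : Type*} [Field K] {σ : Type} (ord : MonomialOrder.{0, 0} σ)
    (I : Ideal (MvPolynomial σ K)) : Ideal (MvPolynomial σ K) :=
  Ideal.span (ord.leadingTerm '' (I : Set (MvPolynomial σ K)))

/-- `J` is generated by squarefree monomials of degree at most `l`. -/
def IsSquarefreeOfDegreeLE {K : Type*} [Field K] {σ : Type}
    (J : Ideal (MvPolynomial σ K)) (l : ℕ) : Prop :=
  ∃ S : Set (σ →₀ ℕ), (∀ u ∈ S, (∀ i, u i ≤ 1) ∧ u.degree ≤ l) ∧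
    J = Ideal.span ((fun u => MvPolynomial.monomial u (1 : K)) '' S)

/-- For some monomial order, the initial ideal of `I` is generated by squarefree monomials of
degree at most `l`. -/
def HasSquarefreeInitialIdeal {K : Type*} [Field K] {σ : Type}
    (I : Ideal (MvPolynomial σ K)) (l : ℕ) : Prop :=
  ∃ ord : MonomialOrder.{0, 0} σ, IsSquarefreeOfDegreeLE (initialIdeal ord I) l

/-- `T` is a triangulation of `P` all of whose vertices are lattice points. -/
def IsLatticeTriangulation {ι : Type} (P : Set (ι → ℝ))
    (T : Geometry.SimplicialComplex ℝ (ι → ℝ)) : Prop :=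
  T.space = P ∧ T.vertices ⊆ toReal '' latticePoints P

/-- `T` is the regular subdivision of `P` induced by a height function `w` on the lattice points of
`P`: the faces of `T` are the nonempty sets `s` of lattice points of `P` that are the contact set
of some affine function lying weakly below `w` (the lower faces of the convex hull of the lifted
points `(a, w a)`). -/
def IsRegular {ι : Type} (P : Set (ι → ℝ)) (T : Geometry.SimplicialComplex ℝ (ι → ℝ)) : Prop :=
  ∃ w : (ι → ℤ) → ℝ, ∀ s : Finset (ι → ℝ), s ∈ T.faces ↔
    s.Nonempty ∧ (s : Set (ι → ℝ)) ⊆ toReal '' latticePoints P ∧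
      ∃ f : (ι → ℝ) →ᵃ[ℝ] ℝ, ∀ a ∈ latticePoints P,
        f (toReal a) ≤ w a ∧ (f (toReal a) = w a ↔ toReal a ∈ s)

/-- Every simplex of `T` is unimodular: for each face with vertex set `s`, the points
`(v, 1)`, `v ∈ s`, generate over `ℤ` every `(a, 1)` with `a` a lattice point of the affine hull
of `s`.  (For a simplex of dimension `|ι|` with lattice vertices this says that the `(v, 1)` form
a basis of `ℤ^ι × ℤ`, i.e. that the simplex has normalized volume one.) -/
def IsUnimodular {ι : Type} (T : Geometry.SimplicialComplex ℝ (ι → ℝ)) : Prop :=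
  ∀ s ∈ T.faces, ∀ a : ι → ℤ, toReal a ∈ affineSpan ℝ (s : Set (ι → ℝ)) →
    (toReal a, (1 : ℝ)) ∈
      AddSubgroup.closure ((fun v : ι → ℝ => (v, (1 : ℝ))) '' (s : Set (ι → ℝ)))

/-- `P` has a regular unimodular triangulation. -/
def HasRegularUnimodularTriangulation {ι : Type} (P : Set (ι → ℝ)) : Prop :=
  ∃ T : Geometry.SimplicialComplex ℝ (ι → ℝ),
    IsLatticeTriangulation P T ∧ IsRegular P T ∧ IsUnimodular T

end

end CayleyMinkowski

/-! A monomial lies outside the initial ideal of a toric ideal exactly when its exponent vector is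
standard, that is, least among the vectors with the same image (`initialIdeal_toricIdeal`). The
hypothesis thus says that the nonstandard vectors are the multiples of squarefree vectors of degree
at most `l`; in particular standardness depends only on the support.

This yields Sturmfels' correspondence. Gordan's theorem gives a rational weight whose strict minimum
on each fibre is the standard vector (`exists_weight`), and the standard supports are the simplices
of the regular triangulation it induces. Their points are independent, their cones cover the cone
over the polytope, and each extends to one whose points generate the lattice
(`exists_standard_generating`, by Dickson's lemma). Unimodularity and IDP follow.

For the Minkowski sum, a lattice point `b` becomes `(b, 1, …, 1)` in `m` times the Cayley sum.
Normality of the Cayley sum splits it into a tuple with one lattice point from each summand; take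
the standard such tuple. Replacing points by tuples sends Minkowski monomials to Cayley monomials
and preserves and reflects having the same toric image. Compare Minkowski monomials first by these
Cayley images, then in favour of spread out points. A monomial is standard iff its Cayley image is
standard and its points form a chain in the entrywise order (`isStandard_tupleMap`,
`not_isStandard_of_not_comparable`, `eq_of_tupleMap_eq`). A failure is witnessed by two incomparable
points, or by at most `l` points whose tuples cover a squarefree generator for the Cayley sum. The
pairs have degree two, so `l ≤ 1` is separate: there the Cayley toric ideal vanishes, every summand
has a single lattice point, and no incomparable pairs exist. -/

namespace CayleyMinkowski

/-! ### Theorems of the alternative -/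

/-- Gordan's theorem of the alternative over a linearly ordered field. -/
theorem exists_forall_pos_or_exists_sum_smul_eq_zero {F : Type*} [Field F] [LinearOrder F]
    [IsStrictOrderedRing F] (n : ℕ) :
    ∀ (V : Type*) [AddCommGroup V] [Module F V] (φ : Fin n → V →ₗ[F] F),
      (∃ x, ∀ i, 0 < φ i x) ∨
        ∃ c : Fin n → F, (∀ i, 0 ≤ c i) ∧ c ≠ 0 ∧ ∑ i, c i • φ i = 0 := by
  induction n with
  | zero => exact fun V _ _ φ => Or.inl ⟨0, fun i => i.elim0⟩
  | succ n ih =>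
    intro V _ _ φ
    by_cases h0 : φ 0 = 0
    · refine Or.inr ⟨Pi.single 0 1, fun i => ?_, by simp, ?_⟩
      · by_cases hi : i = 0
        · subst hi; simp
        · simp [hi]
      · rw [Fin.sum_univ_succ]; simp [h0]
    obtain ⟨y, hy⟩ : ∃ y, φ 0 y = 1 := by
      obtain ⟨y, hy⟩ := DFunLike.ne_iff.1 h0
      exact ⟨(φ 0 y)⁻¹ • y, by simpa using inv_mul_cancel₀ hy⟩
    rcases ih (LinearMap.ker (φ 0)) (fun i => (φ i.succ).comp (Submodule.subtype _)) with
      ⟨x, hx⟩ | ⟨c, hc, hc0, hsum⟩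
    -- The multiple of `x` is large enough to outweigh every `φ i.succ y`, while `φ 0` vanishes at
    -- `x` and equals one at `y`.
    · refine Or.inl ⟨(1 + ∑ i : Fin n, |φ i.succ y| / φ i.succ x) • (x : V) + y, fun i => ?_⟩
      have hx0 : φ 0 (x : V) = 0 := x.2
      have hx' : ∀ i : Fin n, 0 < φ i.succ (x : V) := hx
      refine Fin.cases ?_ (fun j => ?_) i
      · simp [hx0, hy]
      · have h1 : |φ j.succ y| / φ j.succ x ≤ ∑ i : Fin n, |φ i.succ y| / φ i.succ x :=
          Finset.single_le_sum (f := fun i : Fin n => |φ i.succ y| / φ i.succ x)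
            (fun i _ => div_nonneg (abs_nonneg _) (hx' i).le) (Finset.mem_univ j)
        rw [div_le_iff₀ (hx' j)] at h1
        have h2 := neg_abs_le (φ j.succ y)
        simp only [map_add, map_smul, smul_eq_mul]
        nlinarith [hx' j]
    -- Subtracting `φ 0 x • y` moves any `x` into the kernel, so the relation there becomes a
    -- multiple of `φ 0` on all of `V`. The sign of the factor decides what to do.
    · have key : ∀ x, ∑ i, c i * φ i.succ x = (∑ i, c i * φ i.succ y) * φ 0 x := by
        intro x
        have hk : x - φ 0 x • y ∈ LinearMap.ker (φ 0) := by simp [hy]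
        have := LinearMap.congr_fun hsum ⟨_, hk⟩
        simp only [LinearMap.coe_sum, Finset.sum_apply, LinearMap.smul_apply, LinearMap.comp_apply,
          Submodule.subtype_apply, map_sub, map_smul, smul_eq_mul, mul_sub,
          Finset.sum_sub_distrib, LinearMap.zero_apply, sub_eq_zero] at this
        rw [this, Finset.sum_mul]
        exact Finset.sum_congr rfl fun i _ => by ring
      rcases le_or_gt (∑ i, c i * φ i.succ y) 0 with hb | hb
      · refine Or.inr ⟨Fin.cons (-∑ i, c i * φ i.succ y) c, fun i => ?_, ?_, ?_⟩
        · refine Fin.cases ?_ (fun j => ?_) i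
          · simpa using hb
          · simpa using hc j
        · intro h
          exact hc0 (funext fun i => by simpa using congrFun h i.succ)
        · ext x
          simp [Fin.sum_univ_succ, key x]
      -- With a positive factor, `φ 0` is a nonnegative nonzero combination of the others up to
      -- scaling, so it may be dropped.
      · rcases ih V (fun i => φ i.succ) with ⟨x, hx⟩ | ⟨c', hc', hc0', hsum'⟩
        · refine Or.inl ⟨x, fun i => Fin.cases ?_ hx i⟩
          obtain ⟨j, hj⟩ := Function.ne_iff.1 hc0
          have h1 : 0 < ∑ i, c i * φ i.succ x :=
            Finset.sum_pos' (fun i _ => mul_nonneg (hc i) (hx i).le)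
              ⟨j, Finset.mem_univ j, mul_pos (lt_of_le_of_ne (hc j) (Ne.symm hj)) (hx j)⟩
          rw [key x] at h1
          exact pos_of_mul_pos_right h1 hb.le
        · refine Or.inr ⟨Fin.cons 0 c', fun i => ?_, ?_, ?_⟩
          · refine Fin.cases ?_ (fun j => ?_) i
            · simp
            · simpa using hc' j
          · intro h
            exact hc0' (funext fun i => by simpa using congrFun h i.succ)
          · rw [Fin.sum_univ_succ]; simpa using hsum'

theorem exists_nat_mul_eq_intCast {ι : Type*} [Fintype ι] (f : ι → ℚ) :
    ∃ N : ℕ, 0 < N ∧ ∃ n : ι → ℤ, ∀ i, (N : ℚ) * f i = n i := by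
  refine ⟨∏ i, (f i).den, Finset.prod_pos fun i _ => (f i).den_pos, ?_⟩
  have h : ∀ i, ∃ n : ℤ, ((∏ i, (f i).den : ℕ) : ℚ) * f i = n := by
    intro i
    obtain ⟨k, hk⟩ := Finset.dvd_prod_of_mem (fun i => (f i).den) (Finset.mem_univ i)
    refine ⟨k * (f i).num, ?_⟩
    rw [hk]
    push_cast
    rw [mul_comm ((f i).den : ℚ), mul_assoc, Rat.den_mul_eq_num]
  choose n hn using h
  exact ⟨n, hn⟩

/-- An alternative of Gordan–Motzkin type over `ℚ`, with integral multipliers. -/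
theorem exists_pos_zero_or_exists_int_relation {ι κ : Type*} [Fintype ι] [Fintype κ]
    {V : Type*} [AddCommGroup V] [Module ℚ V] (φ : ι → V →ₗ[ℚ] ℚ) (ψ : κ → V →ₗ[ℚ] ℚ) :
    (∃ x, (∀ i, 0 < φ i x) ∧ ∀ k, ψ k x = 0) ∨
      ∃ (c : ι → ℤ) (b : κ → ℤ), (∀ i, 0 ≤ c i) ∧ c ≠ 0 ∧
        ∀ x, ∑ i, (c i : ℚ) * φ i x + ∑ k, (b k : ℚ) * ψ k x = 0 := by
  classical
  let W : Submodule ℚ V := ⨅ k, LinearMap.ker (ψ k)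
  have hW : ∀ x, x ∈ W ↔ ∀ k, ψ k x = 0 := by simp [W]
  let e := Fintype.equivFin ι
  rcases exists_forall_pos_or_exists_sum_smul_eq_zero (Fintype.card ι) W
    (fun i => (φ (e.symm i)).comp W.subtype) with ⟨x, hx⟩ | ⟨c, hc, hc0, hsum⟩
  · refine Or.inl ⟨x, fun i => ?_, (hW x).1 x.2⟩
    simpa using hx (e i)
  · right
    -- A functional vanishing on the common kernel of the `ψ k` is a combination of them;
    -- denominators are cleared afterwards.
    have hspan : (∑ i, c i • φ (e.symm i)) ∈ Submodule.span ℚ (Set.range ψ) := by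
      refine mem_span_of_iInf_ker_le_ker fun x hx => ?_
      have := LinearMap.congr_fun hsum ⟨x, hx⟩
      simpa using this
    obtain ⟨b, hb⟩ := (Submodule.mem_span_range_iff_exists_fun ℚ).1 hspan
    obtain ⟨N, hN, n, hn⟩ := exists_nat_mul_eq_intCast (Sum.elim (fun i => c (e i)) b)
    have hNq : (0 : ℚ) < N := by exact_mod_cast hN
    refine ⟨fun i => n (Sum.inl i), fun k => - n (Sum.inr k), fun i => ?_, ?_, fun x => ?_⟩
    · have h1 := hn (Sum.inl i)
      have : (0 : ℚ) ≤ n (Sum.inl i) := by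
        rw [← h1]; exact mul_nonneg hNq.le (hc _)
      exact_mod_cast this
    · intro h
      apply hc0
      ext i
      have h1 := hn (Sum.inl (e.symm i))
      have h2 : n (Sum.inl (e.symm i)) = 0 := congrFun h (e.symm i)
      rw [h2] at h1
      simpa [hNq.ne'] using h1
    · have hb' := LinearMap.congr_fun hb x
      simp only [LinearMap.coe_sum, Finset.sum_apply, LinearMap.smul_apply, smul_eq_mul] at hb'
      have h1 : ∑ i, c i * φ (e.symm i) x = ∑ i, c (e i) * φ i x := by
        rw [← e.sum_comp]; simp
      rw [h1] at hb'
      have h2 : ∀ i, (n (Sum.inl i) : ℚ) = N * c (e i) := fun i => (hn (Sum.inl i)).symm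
      have h3 : ∀ k, (n (Sum.inr k) : ℚ) = N * b k := fun k => (hn (Sum.inr k)).symm
      push_cast
      simp only [h2, h3, neg_mul, Finset.sum_neg_distrib, mul_assoc, ← Finset.mul_sum, hb']
      ring

/-! ### Standard exponent vectors and a weight selecting them -/

section Standard

variable {σ : Type} {M : Type*} [AddCommMonoid M]

/-- An exponent vector is standard if it is the least one in its fibre under `π`. -/
def IsStandard (ord : MonomialOrder.{0, 0} σ) (π : (σ →₀ ℕ) →+ M) (u : σ →₀ ℕ) : Prop :=
  ∀ v, π v = π u → ord.toSyn u ≤ ord.toSyn v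

/-- The nonstandard exponent vectors are the multiples of squarefree ones of degree at most `l`. -/
def IsSquarefreeFibration (ord : MonomialOrder.{0, 0} σ) (π : (σ →₀ ℕ) →+ M) (l : ℕ) : Prop :=
  ∃ S : Set (σ →₀ ℕ), (∀ u ∈ S, (∀ i, u i ≤ 1) ∧ u.degree ≤ l) ∧
    ∀ u, ¬ IsStandard ord π u ↔ ∃ s ∈ S, s ≤ u

/-- Being standard only depends on the support, and passes to smaller supports. -/
def StandardOfSupport (ord : MonomialOrder.{0, 0} σ) (π : (σ →₀ ℕ) →+ M) : Prop :=
  ∀ u v : σ →₀ ℕ, IsStandard ord π u → v.support ⊆ u.support → IsStandard ord π v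

variable {ord : MonomialOrder.{0, 0} σ} {π : (σ →₀ ℕ) →+ M}

theorem exists_isStandard (ord : MonomialOrder.{0, 0} σ) (π : (σ →₀ ℕ) →+ M) (u : σ →₀ ℕ) :
    ∃ v, π v = π u ∧ IsStandard ord π v ∧ ord.toSyn v ≤ ord.toSyn u := by
  obtain ⟨v, hv, hmin⟩ := (InvImage.wf ord.toSyn (wellFounded_lt (α := ord.syn))).has_min
    {v | π v = π u} ⟨u, rfl⟩
  have hle : ∀ v', π v' = π u → ord.toSyn v ≤ ord.toSyn v' := fun v' hv' => not_lt.1 (hmin v' hv')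
  exact ⟨v, hv, fun v' hv' => hle v' (hv'.trans hv), hle u rfl⟩

theorem IsStandard.eq {u v : σ →₀ ℕ} (hu : IsStandard ord π u) (hv : IsStandard ord π v)
    (h : π u = π v) : u = v :=
  ord.toSyn.injective (le_antisymm (hu v h.symm) (hv u h))

theorem IsStandard.of_le {u v : σ →₀ ℕ} (hu : IsStandard ord π u) (h : v ≤ u) :
    IsStandard ord π v := by
  intro v' hv'
  obtain ⟨d, rfl⟩ := exists_add_of_le h
  have := hu (v' + d) (by simp [hv'])
  rw [map_add, map_add] at this
  exact le_of_add_le_add_right this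

theorem exists_lt_of_not_isStandard {u : σ →₀ ℕ} (hu : ¬ IsStandard ord π u) :
    ∃ v, π v = π u ∧ ord.toSyn v < ord.toSyn u := by
  simpa [IsStandard] using hu

theorem not_isStandard_of_lt {u v : σ →₀ ℕ} (h : π v = π u) (hlt : ord.toSyn v < ord.toSyn u) :
    ¬ IsStandard ord π u := fun hu => not_lt.2 (hu v h) hlt

theorem isStandard_zero : IsStandard ord π 0 := fun v _ => by simp

theorem isStandard_congr {M' : Type*} [AddCommMonoid M'] {π' : (σ →₀ ℕ) →+ M'}
    (h : ∀ u v, π u = π v ↔ π' u = π' v) (u : σ →₀ ℕ) :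
    IsStandard ord π u ↔ IsStandard ord π' u :=
  forall_congr' fun v => by rw [h]

theorem IsSquarefreeFibration.congr {M' : Type*} [AddCommMonoid M'] {π' : (σ →₀ ℕ) →+ M'} {l : ℕ}
    (h : ∀ u v, π u = π v ↔ π' u = π' v) (hS : IsSquarefreeFibration ord π l) :
    IsSquarefreeFibration ord π' l := by
  obtain ⟨S, h1, h2⟩ := hS
  exact ⟨S, h1, fun u => by rw [← isStandard_congr h, h2]⟩

theorem IsSquarefreeFibration.standardOfSupport {l : ℕ} (h : IsSquarefreeFibration ord π l) :
    StandardOfSupport ord π := by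
  obtain ⟨S, hS, hiff⟩ := h
  intro u v hu hvu
  by_contra hv
  obtain ⟨s, hs, hsv⟩ := (hiff v).1 hv
  refine (hiff u).2 ⟨s, hs, fun i => ?_⟩ hu
  by_cases hi : s i = 0
  · omega
  · have h1 : v i ≠ 0 := fun h0 => hi (by have := hsv i; omega)
    have h2 : u i ≠ 0 := by simpa using hvu (Finsupp.mem_support_iff.2 h1)
    have h3 := (hS s hs).1 i
    omega

variable [Fintype σ]

/-- Only finitely many inequalities are needed: each nonstandard 0-1 vector must outweigh some
smaller vector `m A` of its fibre. If they had no common solution, Gordan's alternative would equate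
a nonnegative nonzero combination of the 0-1 vectors with that of the `m A`, contradicting
compatibility of the monomial order with addition. -/
theorem exists_weight (H : StandardOfSupport ord π) :
    ∃ w : σ → ℚ, ∀ u v : σ →₀ ℕ, IsStandard ord π u → π v = π u → v ≠ u →
      ∑ a, w a * u a < ∑ a, w a * v a := by
  classical
  let ind : Finset σ → σ →₀ ℕ := fun A => Finsupp.indicator A fun _ _ => 1
  have hind : ∀ A a, ind A a = if a ∈ A then 1 else 0 := fun A a => by
    simp [ind, Finsupp.indicator_apply]
  let D := {A : Finset σ // ¬ IsStandard ord π (ind A)}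
  have hm : ∀ A : D, ∃ v, π v = π (ind A) ∧ ord.toSyn v < ord.toSyn (ind A) :=
    fun A => exists_lt_of_not_isStandard A.2
  choose m hmπ hmlt using hm
  let φ : D → (σ → ℚ) →ₗ[ℚ] ℚ := fun A =>
    ∑ a, ((ind A a : ℚ) - m A a) • (LinearMap.proj a : (σ → ℚ) →ₗ[ℚ] ℚ)
  have hφ : ∀ A w, φ A w = ∑ a, ((ind A a : ℚ) - m A a) * w a := fun A w => by simp [φ]
  rcases exists_pos_zero_or_exists_int_relation φ
    (fun k : Empty => k.elim) with ⟨w, hw, -⟩ | ⟨c, b, hc, hc0, hrel⟩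
  · refine ⟨w, ?_⟩
    -- A nonstandard `v` contains the indicator of its support, which is nonstandard too; exchanging
    -- it for `m A` lowers both the weight and the order, so descent ends at the standard vector.
    have hstep : ∀ v, ¬ IsStandard ord π v → ∃ v', π v' = π v ∧ ord.toSyn v' < ord.toSyn v ∧
        ∑ a, w a * v' a < ∑ a, w a * v a := by
      intro v hv
      have hA : ¬ IsStandard ord π (ind v.support) := fun h => hv (H _ _ h fun a ha => by
        rw [Finsupp.mem_support_iff, hind, if_pos ha]; exact one_ne_zero)
      have hle : ind v.support ≤ v := fun a => by
        rw [hind]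
        split_ifs with h
        · exact Nat.one_le_iff_ne_zero.2 (Finsupp.mem_support_iff.1 h)
        · exact Nat.zero_le _
      obtain ⟨d, hd⟩ := exists_add_of_le hle
      refine ⟨m ⟨_, hA⟩ + d, ?_, ?_, ?_⟩
      · rw [map_add, hmπ, ← map_add, ← hd]
      · conv_rhs => rw [hd]
        rw [map_add, map_add]
        exact add_lt_add_left (hmlt ⟨_, hA⟩) _
      · have h1 := hw ⟨_, hA⟩
        rw [hφ] at h1
        have h2 : ∀ a, (v a : ℚ) = ind v.support a + d a := fun a => by
          exact_mod_cast DFunLike.congr_fun hd a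
        have h3 : ∑ a, w a * (v a : ℚ) - ∑ a, w a * ((m ⟨_, hA⟩ + d) a : ℚ) =
            ∑ a, ((ind v.support a : ℚ) - m ⟨_, hA⟩ a) * w a := by
          rw [← Finset.sum_sub_distrib]
          refine Finset.sum_congr rfl fun a _ => ?_
          rw [h2 a]
          push_cast [Finsupp.add_apply]
          ring
        linarith
    intro u v hu
    induction hn : ord.toSyn v using WellFoundedLT.induction generalizing v with
    | _ n ih =>
      intro hπ hne
      have hv : ¬ IsStandard ord π v := fun hv => hne (hv.eq hu hπ)
      obtain ⟨v', h1, h2, h3⟩ := hstep v hv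
      by_cases hvu : v' = u
      · rwa [hvu] at h3
      · exact (ih _ (hn ▸ h2) v' rfl (h1.trans hπ) hvu).trans h3
  · exfalso
    have heq : ∑ A : D, (c A).toNat • ind A = ∑ A : D, (c A).toNat • m A := by
      ext a
      have h1 := hrel (Pi.single a 1)
      simp only [hφ, Finset.univ_eq_empty, Finset.sum_empty, add_zero, Pi.single_apply, mul_ite,
        mul_one, mul_zero, Finset.sum_ite_eq', Finset.mem_univ, if_true, mul_sub,
        Finset.sum_sub_distrib, sub_eq_zero] at h1
      have h2 : ∀ A, ((c A).toNat : ℤ) = c A := fun A => Int.toNat_of_nonneg (hc A)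
      simp only [Finsupp.coe_finsetSum, Finset.sum_apply, Finsupp.smul_apply, smul_eq_mul]
      zify
      simp only [h2]
      exact_mod_cast h1
    obtain ⟨A, hA⟩ := Function.ne_iff.1 hc0
    have hlt : ∑ A : D, (c A).toNat • ord.toSyn (m A) <
        ∑ A : D, (c A).toNat • ord.toSyn (ind A) := by
      refine Finset.sum_lt_sum (fun A _ => nsmul_le_nsmul_right (hmlt A).le _)
        ⟨A, Finset.mem_univ _, ?_⟩
      have h0 : (c A).toNat ≠ 0 := by
        have := hc A
        simp only [Pi.zero_apply] at hA
        omega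
      exact nsmul_lt_nsmul_right h0 (hmlt A)
    simp only [← map_nsmul, ← map_sum] at hlt
    rw [heq] at hlt
    exact lt_irrefl _ hlt

end Standard

/-! ### Geometry of the standard supports of an integral configuration -/

section Configuration

variable {σ : Type} [Fintype σ] {κ : Type*}

/-- The map `u ↦ ∑ a, u a • p a` on exponent vectors. -/
def exponentMap (p : σ → κ → ℤ) : (σ →₀ ℕ) →+ (κ → ℤ) where
  toFun u k := ∑ a, (u a : ℤ) * p a k
  map_zero' := by ext; simp
  map_add' u v := by ext; simp [add_mul, Finset.sum_add_distrib]

theorem exponentMap_apply (p : σ → κ → ℤ) (u : σ →₀ ℕ) (k : κ) :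
    exponentMap p u k = ∑ a, (u a : ℤ) * p a k := rfl

theorem exponentMap_single (p : σ → κ → ℤ) (a : σ) : exponentMap p (Finsupp.single a 1) = p a := by
  classical
  ext k
  simp [exponentMap_apply, Finsupp.single_apply]

/-- The exponent vector of the positive part of an integer vector. -/
noncomputable def posPart (z : σ → ℤ) : σ →₀ ℕ := Finsupp.equivFunOnFinite.symm fun a => (z a).toNat

theorem posPart_apply (z : σ → ℤ) (a : σ) : posPart z a = (z a).toNat := rfl

theorem exponentMap_posPart_eq {p : σ → κ → ℤ} {z : σ → ℤ} (hz : ∀ k, ∑ a, z a * p a k = 0) :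
    exponentMap p (posPart z) = exponentMap p (posPart (-z)) := by
  ext k
  rw [← sub_eq_zero, exponentMap_apply, exponentMap_apply, ← Finset.sum_sub_distrib, ← hz k]
  refine Finset.sum_congr rfl fun a _ => ?_
  rw [← sub_mul, posPart_apply, posPart_apply, Pi.neg_apply]
  congr 1
  omega

variable {ord : MonomialOrder.{0, 0} σ} {p : σ → κ → ℤ}

/-- The lattice points in the support of a standard exponent vector are linearly independent. -/
theorem eq_zero_of_sum_mul_eq_zero (H : StandardOfSupport ord (exponentMap p)) {u : σ →₀ ℕ}
    (hu : IsStandard ord (exponentMap p) u) {c : σ → ℝ} (hc : ∀ a, a ∉ u.support → c a = 0)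
    (hsum : ∀ k, ∑ a, c a * p a k = 0) (a : σ) : c a = 0 := by
  by_contra ha
  -- The configuration is integral, so a `ℚ`-linear functional on `ℝ` not vanishing at `c a` turns
  -- the real relation into a rational one.
  obtain ⟨g, hg⟩ : ∃ g : Module.Dual ℚ ℝ, g (c a) ≠ 0 := by
    by_contra! h
    exact ha ((Module.forall_dual_apply_eq_zero_iff ℚ (c a)).1 h)
  obtain ⟨N, hN, z, hz⟩ := exists_nat_mul_eq_intCast fun a => g (c a)
  have hzsum : ∀ k, ∑ a, z a * p a k = 0 := by
    intro k
    have h1 : ∑ a, g (c a) * p a k = 0 := by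
      rw [← map_zero g, ← hsum k, map_sum]
      refine Finset.sum_congr rfl fun a _ => ?_
      have : c a * (p a k : ℝ) = (p a k : ℚ) • c a := by
        rw [Rat.smul_def]; push_cast; ring
      rw [this, map_smul, smul_eq_mul, mul_comm]
    have h2 : (∑ a, (z a : ℚ) * p a k) = 0 := by
      simp only [← hz, mul_assoc, ← Finset.mul_sum, h1, mul_zero]
    exact_mod_cast h2
  have hzu : ∀ a, a ∉ u.support → z a = 0 := fun a ha => by
    have := hz a
    rw [hc a ha, map_zero, mul_zero] at this
    exact_mod_cast this.symm
  have h1 : IsStandard ord (exponentMap p) (posPart z) := H u _ hu fun b hb => by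
    by_contra h
    simp [posPart_apply, hzu b h] at hb
  have h2 : IsStandard ord (exponentMap p) (posPart (-z)) := H u _ hu fun b hb => by
    by_contra h
    simp [posPart_apply, hzu b h] at hb
  -- Positive and negative parts are standard vectors of the same fibre, hence equal; having
  -- disjoint supports, both are zero.
  have h3 := DFunLike.congr_fun (h1.eq h2 (exponentMap_posPart_eq hzsum)) a
  rw [posPart_apply, posPart_apply, Pi.neg_apply] at h3
  have h4 : z a = 0 := by omega
  have h5 := hz a
  rw [h4] at h5
  simp [hg, hN.ne'] at h5

/-- The support of a standard exponent vector is the contact set of a linear functional below the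
weight. -/
theorem exists_contact_functional [Fintype κ] (H : StandardOfSupport ord (exponentMap p))
    {w : σ → ℚ}
    (hw : ∀ u v : σ →₀ ℕ, IsStandard ord (exponentMap p) u → exponentMap p v = exponentMap p u →
      v ≠ u → ∑ a, w a * u a < ∑ a, w a * v a)
    {u : σ →₀ ℕ} (hu : IsStandard ord (exponentMap p) u) :
    ∃ F : κ → ℚ, ∀ a, (a ∈ u.support → ∑ k, F k * p a k = w a) ∧
      (a ∉ u.support → ∑ k, F k * p a k < w a) := by
  classical
  -- The system is homogenised by an extra variable `t > 0`, the component `none` of `φ`; dividing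
  -- by `t` recovers the functional.
  let slack : σ → ((κ → ℚ) × ℚ) →ₗ[ℚ] ℚ := fun a =>
    w a • LinearMap.snd ℚ (κ → ℚ) ℚ -
      ∑ k, (p a k : ℚ) • (LinearMap.proj k).comp (LinearMap.fst ℚ (κ → ℚ) ℚ)
  have hslack : ∀ a x, slack a x = w a * x.2 - ∑ k, (p a k : ℚ) * x.1 k := fun a x => by
    simp [slack]
  let φ : Option {a // a ∉ u.support} → ((κ → ℚ) × ℚ) →ₗ[ℚ] ℚ := fun i =>
    i.elim (LinearMap.snd ℚ (κ → ℚ) ℚ) fun a => slack a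
  rcases exists_pos_zero_or_exists_int_relation φ (fun a : {a // a ∈ u.support} => slack a) with
    ⟨⟨F, t⟩, h1, h2⟩ | ⟨c, b, hc, hc0, hrel⟩
  · have ht : 0 < t := h1 none
    refine ⟨fun k => F k / t, fun a => ⟨fun ha => ?_, fun ha => ?_⟩⟩
    · have h3 := h2 ⟨a, ha⟩
      simp only [hslack] at h3
      simp only [div_mul_eq_mul_div, ← Finset.sum_div]
      rw [div_eq_iff ht.ne', eq_comm, ← sub_eq_zero, ← h3]
      simp only [mul_comm]
    · have h3 : 0 < slack a (F, t) := h1 (some ⟨a, ha⟩)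
      simp only [hslack] at h3
      simp only [div_mul_eq_mul_div, ← Finset.sum_div]
      rw [div_lt_iff₀ ht, ← sub_pos]
      simpa only [mul_comm] using h3
  · exfalso
    let z : σ → ℤ := fun a => if h : a ∈ u.support then b ⟨a, h⟩ else c (some ⟨a, h⟩)
    have hrel' : ∀ x : (κ → ℚ) × ℚ, (c none : ℚ) * x.2 + ∑ a, (z a : ℚ) * slack a x = 0 := by
      intro x
      rw [← hrel x, Fintype.sum_option, add_assoc,
        ← Fintype.sum_subtype_add_sum_subtype (fun a => a ∈ u.support)]
      congr 1
      rw [add_comm]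
      congr 1
      · refine Finset.sum_congr (by ext; simp) fun a _ => ?_
        simp only [z, dif_neg a.2]; rfl
      · refine Finset.sum_congr (by ext; simp) fun a _ => ?_
        simp only [z, dif_pos a.2]
    have hzp : ∀ k, ∑ a, z a * p a k = 0 := by
      intro k
      have h1 := hrel' (Pi.single k 1, 0)
      simp only [hslack, mul_zero, zero_add, zero_sub, Pi.single_apply, mul_ite, mul_one,
        Finset.sum_ite_eq', Finset.mem_univ, if_true, mul_neg, Finset.sum_neg_distrib,
        neg_eq_zero] at h1
      exact_mod_cast h1
    have hzw : (c none : ℚ) + ∑ a, (z a : ℚ) * w a = 0 := by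
      simpa [hslack] using hrel' (0, 1)
    have hz0 : ∀ a, a ∉ u.support → 0 ≤ z a := fun a ha => by
      simp only [z, dif_neg ha]; exact hc _
    have h1 : IsStandard ord (exponentMap p) (posPart (-z)) := H u _ hu fun a ha => by
      by_contra h
      have := hz0 a h
      rw [Finsupp.mem_support_iff, posPart_apply, Pi.neg_apply] at ha
      omega
    have hzpos : ∀ a, (z a : ℚ) = (posPart z a : ℚ) - posPart (-z) a := fun a => by
      have : z a = (posPart z a : ℤ) - posPart (-z) a := by
        rw [posPart_apply, posPart_apply, Pi.neg_apply]; omega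
      exact_mod_cast this
    have hwsum : ∑ a, (z a : ℚ) * w a =
        ∑ a, w a * (posPart z a : ℚ) - ∑ a, w a * (posPart (-z) a : ℚ) := by
      rw [← Finset.sum_sub_distrib]
      exact Finset.sum_congr rfl fun a _ => by rw [hzpos]; ring
    have hcn : (0 : ℚ) ≤ c none := by exact_mod_cast hc none
    -- The negative part of `z` lives on the support of `u`, so it is standard and would be strictly
    -- lighter than the positive part; but the relation makes the weight of `z` nonpositive.
    have heq : posPart z = posPart (-z) := by
      by_contra hne
      have := hw _ _ h1 (exponentMap_posPart_eq hzp) hne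
      linarith
    have hzz : ∀ a, z a = 0 := fun a => by
      have := hzpos a
      rw [heq, sub_self] at this
      exact_mod_cast this
    apply hc0
    ext i
    rcases i with _ | a
    · simp only [hzz, Int.cast_zero, zero_mul, Finset.sum_const_zero, add_zero] at hzw
      exact_mod_cast hzw
    · have := hzz a
      simp only [z, dif_neg a.2] at this
      exact this

/-- Every standard support is contained in one whose points generate the lattice of the
configuration. -/
theorem exists_standard_generating (H : StandardOfSupport ord (exponentMap p)) {u : σ →₀ ℕ}
    (hu : IsStandard ord (exponentMap p) u) :
    ∃ v, IsStandard ord (exponentMap p) v ∧ u.support ⊆ v.support ∧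
      ∀ a, ∃ n : σ → ℤ, (∀ b, b ∉ v.support → n b = 0) ∧ ∀ k, p a k = ∑ b, n b * p b k := by
  classical
  let T : Set (Finset σ) := {A | ∃ v, IsStandard ord (exponentMap p) v ∧ v.support = A}
  obtain ⟨A, hA, hmax⟩ := (Set.toFinite T).exists_le_maximal (a := u.support) ⟨u, hu, rfl⟩
  obtain ⟨v, hv, rfl⟩ := hmax.1
  refine ⟨v, hv, hA, fun a => ?_⟩
  -- `f N` is the standard form of `N • v + e_a`, where `v` has maximal standard support.
  choose f hfπ hfs _ using fun N : ℕ =>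
    exists_isStandard ord (exponentMap p) (N • v + Finsupp.single a 1)
  -- Dickson's lemma. The difference `d` of two comparable standard forms lies in the fibre of `(N'
  -- - N) • v`; both are standard, so they agree. Hence the support of `f N'` contains that of `v`,
  -- and equals it by maximality, so that `p a` is the image of `f N'` minus `N'` times that of `v`.
  obtain ⟨N, N', hlt, hle⟩ := wellQuasiOrdered_le f
  obtain ⟨d, hd⟩ := exists_add_of_le hle
  have hsmul : IsStandard ord (exponentMap p) ((N' - N) • v) := H v _ hv fun b hb => by
    rw [Finsupp.mem_support_iff] at hb ⊢
    intro h
    simp [h] at hb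
  have hdv : d = (N' - N) • v := by
    refine ((hfs N').of_le (by rw [hd]; exact le_add_self)).eq hsmul ?_
    have h1 := hfπ N'
    rw [hd, map_add, hfπ N, ← Nat.sub_add_cancel hlt.le] at h1
    simp only [map_add, map_nsmul, add_smul] at h1 ⊢
    have h2 : (N • exponentMap p v + exponentMap p (Finsupp.single a 1)) + exponentMap p d =
        (N • exponentMap p v + exponentMap p (Finsupp.single a 1)) +
          (N' - N) • exponentMap p v := by rw [h1]; abel
    exact add_left_cancel h2
  have hsub : v.support ⊆ (f N').support := fun b hb => by
    rw [Finsupp.mem_support_iff] at hb ⊢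
    rw [hd, hdv]
    simp [hb, Nat.sub_ne_zero_of_lt hlt]
  have hsub' : (f N').support ⊆ v.support := hmax.2 ⟨_, hfs N', rfl⟩ hsub
  refine ⟨fun b => f N' b - N' * v b, fun b hb => ?_, fun k => ?_⟩
  · have h1 : f N' b = 0 := by
      by_contra h
      exact hb (hsub' (Finsupp.mem_support_iff.2 h))
    have h2 : v b = 0 := by simpa using hb
    simp [h1, h2]
  · have h1 := congrFun (hfπ N') k
    rw [map_add, map_nsmul, exponentMap_single] at h1
    simp only [Pi.add_apply, nsmul_eq_mul, Pi.mul_apply, Pi.natCast_apply, exponentMap_apply, sub_mul,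
      Finset.sum_sub_distrib, mul_assoc, ← Finset.mul_sum] at h1 ⊢
    linarith

/-- Every point of the real cone over the configuration lies in the cone over a standard support. -/
theorem exists_standard_representation [Fintype κ] {w : σ → ℚ}
    (hw : ∀ u v : σ →₀ ℕ, IsStandard ord (exponentMap p) u → exponentMap p v = exponentMap p u →
      v ≠ u → ∑ a, w a * u a < ∑ a, w a * v a)
    {k₀ : κ} (hk₀ : ∀ a, p a k₀ = 1) {c : σ → ℝ} (hc : ∀ a, 0 ≤ c a) :
    ∃ (x : σ → ℝ) (u : σ →₀ ℕ), (∀ a, 0 ≤ x a) ∧ IsStandard ord (exponentMap p) u ∧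
      (∀ a, a ∉ u.support → x a = 0) ∧ ∀ k, ∑ a, x a * p a k = ∑ a, c a * p a k := by
  classical
  -- The representations of the given point form a compact set, bounded because the coordinate `k₀`
  -- fixes the total mass. One of least weight has standard support: otherwise a small step from the
  -- indicator of its support towards the standard vector of that fibre would lower the weight.
  let K : Set (σ → ℝ) := {x | (∀ a, 0 ≤ x a) ∧ ∀ k, ∑ a, x a * p a k = ∑ a, c a * p a k}
  have hKc : IsClosed K := by
    simp only [K, Set.ofPred_and, Set.ofPred_forall]
    refine (isClosed_iInter fun a => isClosed_le (by fun_prop) (by fun_prop)).inter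
      (isClosed_iInter fun k => isClosed_eq (by fun_prop) (by fun_prop))
  have hKb : K ⊆ Set.Icc 0 (fun _ => ∑ a, c a) := fun x hx => by
    refine ⟨hx.1, fun a => ?_⟩
    have h1 := hx.2 k₀
    simp only [hk₀, Int.cast_one, mul_one] at h1
    rw [← h1]
    exact Finset.single_le_sum (fun a _ => hx.1 a) (Finset.mem_univ a)
  have hK : IsCompact K := isCompact_Icc.of_isClosed_subset hKc hKb
  obtain ⟨x, hx, hmin⟩ := hK.exists_isMinOn ⟨c, hc, fun _ => rfl⟩
    (f := fun x => ∑ a, (w a : ℝ) * x a) (by fun_prop)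
  let A : Finset σ := Finset.univ.filter fun a => x a ≠ 0
  let u : σ →₀ ℕ := Finsupp.indicator A fun _ _ => 1
  have hu : ∀ a, u a = if a ∈ A then 1 else 0 := fun a => by simp [u, Finsupp.indicator_apply]
  refine ⟨x, u, hx.1, ?_, fun a ha => ?_, hx.2⟩
  swap
  · by_contra h
    apply ha
    rw [Finsupp.mem_support_iff, hu, if_pos (by simpa [A] using h)]
    exact one_ne_zero
  by_contra hns
  obtain ⟨v, hvπ, hvs, -⟩ := exists_isStandard ord (exponentMap p) u
  have hlt : ∑ a, w a * v a < ∑ a, w a * u a :=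
    hw v u hvs hvπ.symm fun h => hns (h ▸ hvs)
  obtain ⟨ε, hε, hεx⟩ : ∃ ε : ℝ, 0 < ε ∧ ∀ a ∈ A, ε ≤ x a := by
    rcases A.eq_empty_or_nonempty with h | h
    · exact ⟨1, one_pos, by simp [h]⟩
    · obtain ⟨a, ha, hmin⟩ := A.exists_min_image x h
      exact ⟨x a, lt_of_le_of_ne (hx.1 a) (Ne.symm (by simpa [A] using ha)), hmin⟩
  let y : σ → ℝ := fun a => x a + ε * ((v a : ℝ) - u a)
  have hy : y ∈ K := by
    refine ⟨fun a => ?_, fun k => ?_⟩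
    · have h1 : (0 : ℝ) ≤ v a := Nat.cast_nonneg _
      by_cases ha : a ∈ A
      · have h2 := hεx a ha
        simp only [y, hu, if_pos ha, Nat.cast_one]
        nlinarith
      · simp only [y, hu, if_neg ha, Nat.cast_zero, sub_zero]
        have := hx.1 a
        positivity
    · have h1 : ∑ a, (v a : ℝ) * p a k = ∑ a, (u a : ℝ) * p a k := by
        have := congrFun hvπ k
        simp only [exponentMap_apply] at this
        exact_mod_cast this
      rw [← hx.2 k]
      simp only [y, add_mul, mul_assoc, sub_mul, Finset.sum_add_distrib, ← Finset.mul_sum,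
        Finset.sum_sub_distrib, h1]
      ring
  have hlt' : ∑ a, (w a : ℝ) * v a < ∑ a, (w a : ℝ) * u a := by exact_mod_cast hlt
  have hle : ∑ a, (w a : ℝ) * x a ≤ ∑ a, (w a : ℝ) * y a := hmin hy
  have heq : ∑ a, (w a : ℝ) * y a =
      ∑ a, (w a : ℝ) * x a + ε * (∑ a, (w a : ℝ) * v a - ∑ a, (w a : ℝ) * u a) := by
    rw [← Finset.sum_sub_distrib, Finset.mul_sum, ← Finset.sum_add_distrib]
    exact Finset.sum_congr rfl fun a _ => by simp only [y]; ring
  nlinarith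

/-- If an integral combination of the configuration is a real combination of the points in a
standard support, then the real coefficients are integers. -/
theorem exists_int_coefficients (H : StandardOfSupport ord (exponentMap p)) {u : σ →₀ ℕ}
    (hu : IsStandard ord (exponentMap p) u) {x : σ → ℝ} (hxu : ∀ a, a ∉ u.support → x a = 0)
    {n : σ → ℤ} (hn : ∀ k, ∑ a, x a * p a k = ((∑ a, n a * p a k : ℤ) : ℝ)) :
    ∃ z : σ → ℤ, ∀ a, x a = z a := by
  obtain ⟨v, hv, huv, hgen⟩ := exists_standard_generating H hu
  choose m hm hmp using hgen
  -- Integral coefficients come from rewriting every point through a generating standard support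
  -- that contains the given one; independence there identifies them with `x`.
  let z : σ → ℤ := fun b => ∑ a, n a * m a b
  have hz : ∀ k, ∑ b, z b * p b k = ∑ a, n a * p a k := fun k => by
    simp only [z, Finset.sum_mul]
    rw [Finset.sum_comm]
    refine Finset.sum_congr rfl fun a _ => ?_
    rw [hmp a k, Finset.mul_sum]
    simp only [mul_assoc]
  refine ⟨z, fun b => sub_eq_zero.1 ?_⟩
  refine eq_zero_of_sum_mul_eq_zero H hv (c := fun b => x b - z b) (fun b hb => ?_) (fun k => ?_) b
  · have h1 : z b = 0 := Finset.sum_eq_zero fun a _ => by rw [hm a b hb, mul_zero]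
    rw [hxu b fun h => hb (huv h), h1]
    simp
  · simp only [sub_mul, Finset.sum_sub_distrib]
    rw [hn k, sub_eq_zero, ← hz k]
    push_cast
    rfl

/-- A lattice point of the real cone over the configuration is a sum of points of the
configuration. -/
theorem exists_exponentMap_eq [Fintype κ] (H : StandardOfSupport ord (exponentMap p))
    {k₀ : κ} (hk₀ : ∀ a, p a k₀ = 1) {c : σ → ℝ} (hc : ∀ a, 0 ≤ c a) {q : κ → ℤ}
    (hq : ∀ k, ∑ a, c a * p a k = q k) {n : σ → ℤ} (hn : ∀ k, ∑ a, n a * p a k = q k) :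
    ∃ u, exponentMap p u = q := by
  obtain ⟨w, hw⟩ := exists_weight H
  obtain ⟨x, u, hx, hu, hxu, hsum⟩ := exists_standard_representation hw hk₀ hc
  obtain ⟨z, hz⟩ := exists_int_coefficients H hu hxu (n := n) fun k => by rw [hsum, hq, hn]
  have hz0 : ∀ b, 0 ≤ z b := fun b => by
    have := hx b
    rw [hz] at this
    exact_mod_cast this
  refine ⟨posPart z, ?_⟩
  ext k
  have h1 := (hsum k).trans (hq k)
  simp only [hz] at h1
  rw [exponentMap_apply]
  simp only [posPart_apply, Int.toNat_of_nonneg (hz0 _)]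
  exact_mod_cast h1

/-- Two nonnegative combinations of standard supports with the same value are both supported on
the intersection of the supports. -/
theorem eq_zero_of_sum_mul_eq_sum_mul [Fintype κ] (H : StandardOfSupport ord (exponentMap p))
    {u v : σ →₀ ℕ} (hu : IsStandard ord (exponentMap p) u) (hv : IsStandard ord (exponentMap p) v)
    {x y : σ → ℝ} (hy : ∀ a, 0 ≤ y a) (hx : ∀ a, 0 ≤ x a)
    (hxu : ∀ a, a ∉ u.support → x a = 0) (hyv : ∀ a, a ∉ v.support → y a = 0)
    (hxy : ∀ k, ∑ a, x a * p a k = ∑ a, y a * p a k) {a : σ} (ha : a ∉ u.support) : y a = 0 := by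
  obtain ⟨w, hw⟩ := exists_weight H
  -- The slack `s` of the contact functional of `u` vanishes on the support of `u`, so passing from
  -- `x` to `y` raises the weight by the slack of `y`. Exchanging the roles forces both slacks to
  -- vanish.
  have key : ∀ {u : σ →₀ ℕ} (_ : IsStandard ord (exponentMap p) u) {x y : σ → ℝ}
      (_ : ∀ a, 0 ≤ y a) (_ : ∀ a, a ∉ u.support → x a = 0)
      (_ : ∀ k, ∑ a, x a * p a k = ∑ a, y a * p a k), ∃ s : σ → ℝ, (∀ a, 0 ≤ s a) ∧
        (∀ a, a ∉ u.support → 0 < s a) ∧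
        ∑ a, y a * w a = ∑ a, x a * w a + ∑ a, y a * s a := by
    intro u hu x y hy hxu hxy
    obtain ⟨F, hF⟩ := exists_contact_functional H hw hu
    refine ⟨fun a => ((w a - ∑ k, F k * p a k : ℚ) : ℝ), fun a => ?_, fun a ha => ?_, ?_⟩
    · by_cases ha : a ∈ u.support
      · simp only [(hF a).1 ha, sub_self, Rat.cast_zero, le_refl]
      · exact Rat.cast_nonneg.2 (sub_pos.2 ((hF a).2 ha)).le
    · exact Rat.cast_pos.2 (sub_pos.2 ((hF a).2 ha))
    · have h1 : ∑ a, x a * (w a : ℝ) = ∑ a, x a * ((∑ k, F k * p a k : ℚ) : ℝ) := by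
        refine Finset.sum_congr rfl fun a _ => ?_
        by_cases ha : a ∈ u.support
        · rw [(hF a).1 ha]
        · rw [hxu a ha, zero_mul, zero_mul]
      have h2 : ∀ x : σ → ℝ, ∑ a, x a * ((∑ k, F k * p a k : ℚ) : ℝ) =
          ∑ k, (F k : ℝ) * ∑ a, x a * p a k := fun x => by
        simp only [Finset.mul_sum, Rat.cast_sum, Rat.cast_mul, Rat.cast_intCast]
        rw [Finset.sum_comm]
        exact Finset.sum_congr rfl fun k _ => Finset.sum_congr rfl fun a _ => by ring
      rw [h1, h2]
      simp only [hxy]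
      rw [← h2, ← Finset.sum_add_distrib]
      exact Finset.sum_congr rfl fun a _ => by push_cast; ring
  obtain ⟨s, hs, hsu, h1⟩ := key hu hy hxu hxy
  obtain ⟨t, ht, -, h2⟩ := key hv hx hyv fun k => (hxy k).symm
  have h3 : 0 ≤ ∑ a, x a * t a := Finset.sum_nonneg fun a _ => mul_nonneg (hx a) (ht a)
  have h4 : ∑ a, y a * s a = 0 := le_antisymm (by linarith)
    (Finset.sum_nonneg fun a _ => mul_nonneg (hy a) (hs a))
  have h5 := (Finset.sum_eq_zero_iff_of_nonneg fun a _ => mul_nonneg (hy a) (hs a)).1 h4 a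
    (Finset.mem_univ a)
  exact (mul_eq_zero.1 h5).resolve_right (hsu a ha).ne'

end Configuration

/-! ### Additive maps on exponent vectors -/

section Combination

variable {σ : Type*} {M : Type*} [AddCommMonoid M]

/-- The additive map on exponent vectors with prescribed values on the unit vectors. -/
noncomputable def natCombination (p : σ → M) : (σ →₀ ℕ) →+ M :=
  Finsupp.liftAddHom fun a => multiplesHom M (p a)

theorem natCombination_single (p : σ → M) (a : σ) (n : ℕ) :
    natCombination p (Finsupp.single a n) = n • p a := by
  simp [natCombination]

theorem natCombination_apply [Fintype σ] (p : σ → M) (u : σ →₀ ℕ) :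
    natCombination p u = ∑ a, u a • p a := by
  rw [natCombination, Finsupp.liftAddHom_apply, Finsupp.sum_fintype _ _ (by simp)]
  simp

end Combination

/-! ### From toric ideals to fibres of exponent vectors -/

section Bridge

variable {K : Type*} [Field K] {ι : Type}

/-- The exponent vector of the image of a monomial under the toric map. -/
noncomputable def toricExponent (P : Set (ι → ℝ)) :
    (latticePoints P →₀ ℕ) →+ (ι → ℤ) × ℕ :=
  natCombination fun a => ((a : ι → ℤ), 1)

theorem toricExponent_single (P : Set (ι → ℝ)) (a : latticePoints P) (n : ℕ) :
    toricExponent P (Finsupp.single a n) = n • ((a : ι → ℤ), 1) :=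
  natCombination_single _ a n

theorem toricMap_monomial (P : Set (ι → ℝ)) (u : latticePoints P →₀ ℕ) (c : K) :
    toricMap K P (MvPolynomial.monomial u c) = AddMonoidAlgebra.single (toricExponent P u) c := by
  induction u using Finsupp.induction_linear generalizing c with
  | zero =>
    rw [map_zero]
    exact AlgHom.commutes _ c
  | add u v hu hv =>
    rw [← mul_one c, ← MvPolynomial.monomial_mul, map_mul, hu, hv, map_add,
      AddMonoidAlgebra.single_mul_single]
  | single a n =>
    rw [toricMap, MvPolynomial.aeval_monomial, toricExponent_single]
    simp [AddMonoidAlgebra.single_pow, AddMonoidAlgebra.single_mul_single]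

theorem monomial_sub_monomial_mem_toricIdeal {P : Set (ι → ℝ)} {u v : latticePoints P →₀ ℕ}
    (h : toricExponent P v = toricExponent P u) :
    MvPolynomial.monomial u (1 : K) - MvPolynomial.monomial v 1 ∈ toricIdeal K P := by
  rw [toricIdeal, RingHom.mem_ker, map_sub, toricMap_monomial, toricMap_monomial, h, sub_self]

open scoped Classical in
theorem sum_coeff_fiber_eq_zero {P : Set (ι → ℝ)} {f : MvPolynomial (latticePoints P) K}
    (hf : f ∈ toricIdeal K P) (x : (ι → ℤ) × ℕ) :
    ∑ u ∈ f.support with toricExponent P u = x, f.coeff u = 0 := by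
  rw [toricIdeal, RingHom.mem_ker, ← f.support_sum_monomial_coeff, map_sum] at hf
  simp only [toricMap_monomial] at hf
  have := congrArg (fun f => f.coeff x) hf
  rw [Finset.sum_filter]
  simpa [AddMonoidAlgebra.coeff_sum, Finsupp.single_apply] using this

/-- If a leading exponent were standard, no other term of the polynomial could share its fibre, yet
the coefficients over a fibre sum to zero. Conversely a nonstandard vector leads the binomial formed
with a smaller vector of its fibre. -/
theorem initialIdeal_toricIdeal (P : Set (ι → ℝ)) (ord : MonomialOrder.{0, 0} (latticePoints P)) :
    initialIdeal ord (toricIdeal K P) = Ideal.span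
      ((fun u => MvPolynomial.monomial u (1 : K)) '' {u | ¬ IsStandard ord (toricExponent P) u}) := by
  classical
  apply le_antisymm
  · rw [initialIdeal, Ideal.span_le]
    rintro _ ⟨f, hf, rfl⟩
    by_cases hf0 : f = 0
    · simp [hf0]
    have hns : ¬ IsStandard ord (toricExponent P) (ord.degree f) := by
      intro hst
      have h1 := sum_coeff_fiber_eq_zero hf (toricExponent P (ord.degree f))
      rw [Finset.sum_eq_single_of_mem (ord.degree f)] at h1
      · exact ord.leadingCoeff_ne_zero_iff.2 hf0 h1
      · exact Finset.mem_filter.2 ⟨ord.degree_mem_support hf0, rfl⟩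
      · intro v hv hne
        rw [Finset.mem_filter] at hv
        exact absurd (ord.toSyn.injective (le_antisymm (ord.le_degree hv.1) (hst v hv.2))) hne
    rw [MonomialOrder.leadingTerm, ← mul_one (ord.leadingCoeff f), ← MvPolynomial.C_mul_monomial]
    exact Ideal.mul_mem_left _ _ (Ideal.subset_span ⟨_, hns, rfl⟩)
  · rw [Ideal.span_le]
    rintro _ ⟨u, hu, rfl⟩
    obtain ⟨v, hv, hlt⟩ := exists_lt_of_not_isStandard hu
    refine Ideal.subset_span ⟨_, monomial_sub_monomial_mem_toricIdeal hv, ?_⟩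
    have h1 : ord.toSyn (ord.degree (MvPolynomial.monomial v (1 : K))) <
        ord.toSyn (ord.degree (MvPolynomial.monomial u (1 : K))) := by
      simpa [ord.degree_monomial] using hlt
    rw [MonomialOrder.leadingTerm, ord.degree_sub_of_lt h1, ord.leadingCoeff_sub_of_lt h1,
      ord.leadingCoeff_monomial, ord.degree_monomial, if_neg one_ne_zero]

theorem monomial_mem_span_iff {σ : Type} {S : Set (σ →₀ ℕ)} {u : σ →₀ ℕ} :
    MvPolynomial.monomial u (1 : K) ∈
      Ideal.span ((fun u => MvPolynomial.monomial u (1 : K)) '' S) ↔ ∃ s ∈ S, s ≤ u := by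
  classical
  rw [MvPolynomial.mem_ideal_span_monomial_image, MvPolynomial.support_monomial,
    if_neg one_ne_zero]
  simp

/-- The combinatorial form of the existence of a squarefree initial ideal. -/
theorem hasSquarefreeInitialIdeal_toricIdeal_iff (P : Set (ι → ℝ)) (l : ℕ) :
    HasSquarefreeInitialIdeal (toricIdeal K P) l ↔
      ∃ ord : MonomialOrder.{0, 0} (latticePoints P),
        IsSquarefreeFibration ord (toricExponent P) l := by
  refine exists_congr fun ord => ?_
  rw [IsSquarefreeOfDegreeLE, initialIdeal_toricIdeal]
  refine exists_congr fun S => and_congr_right fun _ => ?_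
  constructor
  · intro h u
    rw [← monomial_mem_span_iff (K := K), ← h, monomial_mem_span_iff]
    exact ⟨fun hu => ⟨u, hu, le_rfl⟩, fun ⟨s, hs, hsu⟩ hu => hs (hu.of_le hsu)⟩
  · intro h
    ext f
    simp only [MvPolynomial.mem_ideal_span_monomial_image]
    refine forall₂_congr fun u _ => ?_
    rw [← h]
    exact ⟨fun ⟨s, hs, hsu⟩ hu => hs (hu.of_le hsu), fun hu => ⟨u, hu, le_rfl⟩⟩

/-- The lattice points of `P` lifted to height one. -/
def liftedPoint (P : Set (ι → ℝ)) (a : latticePoints P) : Option ι → ℤ :=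
  fun o => o.elim 1 (a : ι → ℤ)

theorem toricExponent_fst (P : Set (ι → ℝ)) [Fintype (latticePoints P)] (u : latticePoints P →₀ ℕ)
    (i : ι) : (toricExponent P u).1 i = exponentMap (liftedPoint P) u (some i) := by
  induction u using Finsupp.induction_linear with
  | zero => simp
  | add u v hu hv => simp [hu, hv]
  | single a n =>
    classical
    rw [toricExponent_single, exponentMap_apply]
    simp [liftedPoint, Finsupp.single_apply]

theorem toricExponent_snd (P : Set (ι → ℝ)) [Fintype (latticePoints P)]
    (u : latticePoints P →₀ ℕ) :
    ((toricExponent P u).2 : ℤ) = exponentMap (liftedPoint P) u none := by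
  induction u using Finsupp.induction_linear with
  | zero => simp
  | add u v hu hv => simp [hu, hv]
  | single a n =>
    classical
    rw [toricExponent_single, exponentMap_apply]
    simp [liftedPoint, Finsupp.single_apply]

theorem toricExponent_eq_iff (P : Set (ι → ℝ)) [Fintype (latticePoints P)]
    (u v : latticePoints P →₀ ℕ) :
    toricExponent P u = toricExponent P v ↔
      exponentMap (liftedPoint P) u = exponentMap (liftedPoint P) v := by
  rw [Prod.ext_iff, funext_iff, funext_iff, Option.forall, ← toricExponent_snd,
    ← toricExponent_snd, Nat.cast_inj, and_comm]
  simp only [toricExponent_fst]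

end Bridge

/-! ### Lattice points of polytopes and integer decomposition -/

section Polytope

theorem mem_convexHull_image_iff {σ E : Type*} [Fintype σ] [AddCommGroup E] [Module ℝ E]
    (e : σ → E) (A : Set σ) (x : E) :
    x ∈ convexHull ℝ (e '' A) ↔ ∃ c : σ → ℝ, (∀ a, 0 ≤ c a) ∧ (∀ a, a ∉ A → c a = 0) ∧
      ∑ a, c a = 1 ∧ ∑ a, c a • e a = x := by
  classical
  constructor
  · intro hx
    let C : Set E := {x | ∃ c : σ → ℝ, (∀ a, 0 ≤ c a) ∧ (∀ a, a ∉ A → c a = 0) ∧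
      ∑ a, c a = 1 ∧ ∑ a, c a • e a = x}
    have hC : Convex ℝ C := by
      rintro _ ⟨c, hc, hcA, hc1, rfl⟩ _ ⟨c', hc', hcA', hc1', rfl⟩ s t hs ht hst
      refine ⟨fun a => s * c a + t * c' a, fun a => ?_, fun a ha => ?_, ?_, ?_⟩
      · have := hc a
        have := hc' a
        positivity
      · simp [hcA a ha, hcA' a ha]
      · rw [Finset.sum_add_distrib, ← Finset.mul_sum, ← Finset.mul_sum, hc1, hc1']; simpa using hst
      · simp only [add_smul, mul_smul, Finset.sum_add_distrib, ← Finset.smul_sum]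
    refine convexHull_min ?_ hC hx
    rintro _ ⟨a, ha, rfl⟩
    refine ⟨Pi.single a 1, fun b => ?_, fun b hb => ?_, by simp, ?_⟩
    · by_cases h : b = a
      · subst h; simp
      · simp [h]
    · have : b ≠ a := fun h => hb (h ▸ ha)
      simp [this]
    · simp [Pi.single_apply]
  · rintro ⟨c, hc, hcA, hc1, rfl⟩
    have h0 : ∀ a ∈ Finset.univ, a ∉ Finset.univ.filter (· ∈ A) → c a = 0 := fun a _ ha =>
      hcA a (by simpa using ha)
    rw [← Finset.sum_subset (Finset.filter_subset (· ∈ A) Finset.univ) h0] at hc1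
    rw [← Finset.sum_subset (Finset.filter_subset (· ∈ A) Finset.univ)
      fun a h1 h2 => by rw [h0 a h1 h2, zero_smul]]
    exact (convex_convexHull ℝ _).sum_mem (fun a _ => hc a) hc1
      fun a ha => subset_convexHull ℝ _ ⟨a, (Finset.mem_filter.1 ha).2, rfl⟩

variable {ι : Type} {P : Set (ι → ℝ)}

theorem toReal_injective : Function.Injective (toReal : (ι → ℤ) → ι → ℝ) := fun a b h => by
  ext i
  exact Int.cast_injective (congrFun h i)

/-- A lattice point of `P`, seen in real space. -/
def realPoint (P : Set (ι → ℝ)) (a : latticePoints P) : ι → ℝ := toReal a.1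

theorem realPoint_injective (P : Set (ι → ℝ)) : Function.Injective (realPoint P) :=
  toReal_injective.comp Subtype.val_injective

theorem IsLatticePolytope.convex (hP : IsLatticePolytope P) : Convex ℝ P := by
  obtain ⟨V, -, rfl⟩ := hP
  exact convex_convexHull ℝ _

theorem IsLatticePolytope.eq_convexHull (hP : IsLatticePolytope P) :
    P = convexHull ℝ (Set.range (realPoint P)) := by
  apply le_antisymm
  · obtain ⟨V, hV, hPV⟩ := hP
    conv_lhs => rw [hPV]
    apply convexHull_mono
    rintro _ ⟨v, hv, rfl⟩
    exact ⟨⟨v, by rw [latticePoints, Set.mem_ofPred_eq, hPV]; exact subset_convexHull ℝ _ ⟨v, hv, rfl⟩⟩,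
      rfl⟩
  · refine convexHull_min ?_ hP.convex
    rintro _ ⟨a, rfl⟩
    exact a.2

theorem IsLatticePolytope.finite_latticePoints [Fintype ι] (hP : IsLatticePolytope P) :
    (latticePoints P).Finite := by
  classical
  obtain ⟨V, -, rfl⟩ := hP
  have hb := (V.finite_toSet.image toReal).isCompact_convexHull ℝ |>.isBounded
  obtain ⟨C, hC⟩ := hb.exists_norm_le
  refine (Set.finite_Icc (fun _ => -⌈C⌉) (fun _ => ⌈C⌉)).subset fun a ha => ?_
  have h1 : ∀ i, |a i| ≤ ⌈C⌉ := fun i => by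
    have h2 := (norm_le_pi_norm (toReal a) i).trans ((hC _ ha).trans (Int.le_ceil C))
    rw [Real.norm_eq_abs, toReal] at h2
    exact_mod_cast h2
  exact ⟨fun i => (abs_le.1 (h1 i)).1, fun i => (abs_le.1 (h1 i)).2⟩

theorem exists_sum_mul_liftedPoint [Fintype (latticePoints P)] (hlat : liftedLattice P = ⊤)
    (q : Option ι → ℤ) : ∃ n : latticePoints P → ℤ, ∀ k, ∑ a, n a * liftedPoint P a k = q k := by
  classical
  have key : ∀ y ∈ liftedLattice P, ∃ n : latticePoints P → ℤ,
      (∀ i, ∑ a, n a * (a : ι → ℤ) i = y.1 i) ∧ ∑ a, n a = y.2 := by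
    intro y hy
    induction hy using AddSubgroup.closure_induction with
    | mem y hy =>
      obtain ⟨a, ha, rfl⟩ := hy
      exact ⟨Pi.single ⟨a, ha⟩ 1, by simp [Pi.single_apply], by simp⟩
    | zero => exact ⟨0, by simp, by simp⟩
    | add x y _ _ hx hy =>
      obtain ⟨n, h1, h2⟩ := hx
      obtain ⟨n', h1', h2'⟩ := hy
      exact ⟨n + n', by simp [add_mul, Finset.sum_add_distrib, h1, h1'],
        by simp [Finset.sum_add_distrib, h2, h2']⟩
    | neg x _ hx =>
      obtain ⟨n, h1, h2⟩ := hx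
      exact ⟨-n, by simp [h1], by simp [h2]⟩
  obtain ⟨n, h1, h2⟩ := key (fun i => q (some i), q none) (hlat ▸ AddSubgroup.mem_top _)
  refine ⟨n, fun k => ?_⟩
  rcases k with _ | i
  · simpa [liftedPoint] using h2
  · exact h1 i

theorem sum_smul_toReal_eq_iff [Fintype (latticePoints P)] {c : latticePoints P → ℝ}
    {x : ι → ℝ} {r : ℝ} :
    (∑ a, c a = r ∧ ∑ a, c a • realPoint P a = x) ↔
      ∀ k, ∑ a, c a * (liftedPoint P a k : ℝ) = (k.elim r x : ℝ) := by
  rw [Option.forall, funext_iff]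
  simp [liftedPoint, realPoint, toReal]

theorem mem_convexHull_toReal_iff [Fintype (latticePoints P)] {A : Set (latticePoints P)}
    {x : ι → ℝ} :
    x ∈ convexHull ℝ (realPoint P '' A) ↔
      ∃ c : latticePoints P → ℝ, (∀ a, 0 ≤ c a) ∧ (∀ a, a ∉ A → c a = 0) ∧
        ∀ k, ∑ a, c a * (liftedPoint P a k : ℝ) = (k.elim 1 x : ℝ) := by
  simp only [mem_convexHull_image_iff, sum_smul_toReal_eq_iff]

/-- Normality: lattice points of `kP` are the height `k` lattice points of the cone over the lifted
points. Besides IDP, it supplies the decomposition of lattice points of the Minkowski sum. -/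
theorem exists_exponentMap_of_mem_smul [Fintype ι] [Fintype (latticePoints P)]
    (hP : IsLatticePolytope P) (hlat : liftedLattice P = ⊤)
    {ord : MonomialOrder.{0, 0} (latticePoints P)}
    (H : StandardOfSupport ord (exponentMap (liftedPoint P))) {k : ℕ} {z : ι → ℤ}
    (hz : toReal z ∈ (k : ℝ) • P) :
    ∃ u, exponentMap (liftedPoint P) u = fun o => o.elim (k : ℤ) z := by
  obtain ⟨x, hx, hxz⟩ := hz
  rw [hP.eq_convexHull, ← Set.image_univ, mem_convexHull_toReal_iff] at hx
  obtain ⟨c, hc, -, hcx⟩ := hx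
  obtain ⟨n, hn⟩ := exists_sum_mul_liftedPoint hlat fun o => o.elim (k : ℤ) z
  refine exists_exponentMap_eq H (k₀ := none) (c := fun a => k * c a) (fun _ => rfl)
    (fun a => mul_nonneg (Nat.cast_nonneg _) (hc a)) (fun o => ?_) hn
  simp only [mul_assoc, ← Finset.mul_sum, hcx]
  rcases o with _ | i
  · simp
  · exact congrFun hxz i

theorem IsLatticePolytope.isIDP [Fintype ι] [Fintype (latticePoints P)]
    (hP : IsLatticePolytope P) (hlat : liftedLattice P = ⊤)
    {ord : MonomialOrder.{0, 0} (latticePoints P)}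
    (H : StandardOfSupport ord (exponentMap (liftedPoint P))) : IsIDP P := by
  classical
  intro k hk
  have hk0 : (0 : ℝ) < k := by exact_mod_cast hk
  apply Set.Subset.antisymm
  · rintro _ ⟨a, ha, b, hb, rfl⟩
    change toReal (a + b) ∈ ((k : ℝ) + 1) • P
    have h1 : toReal (a + b) = toReal a + toReal b := by ext; simp [toReal]
    rw [add_comm, hP.convex.add_smul zero_le_one hk0.le, one_smul, h1]
    exact Set.add_mem_add ha hb
  · intro z hz
    obtain ⟨u, hu⟩ := exists_exponentMap_of_mem_smul (k := k + 1) hP hlat H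
      (by push_cast; exact hz)
    have hdeg : ∑ a, u a = k + 1 := by
      have := congrFun hu none
      simp only [exponentMap_apply, liftedPoint, Option.elim_none, mul_one] at this
      exact_mod_cast this
    obtain ⟨a, ha⟩ : ∃ a, u a ≠ 0 := by
      by_contra! h
      simp [h] at hdeg
    -- One of the `k + 1` summands is split off; the average of the other `k` lies in `P`.
    obtain ⟨v, rfl⟩ := exists_add_of_le (show Finsupp.single a 1 ≤ u by
      rw [Finsupp.single_le_iff]; omega)
    have hdegv : ∑ b, v b = k := by
      simp only [Finsupp.add_apply, Finset.sum_add_distrib, Finsupp.single_apply,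
        Finset.sum_ite_eq, Finset.mem_univ, if_true] at hdeg
      omega
    refine ⟨a, a.2, fun i => exponentMap (liftedPoint P) v (some i), ?_, ?_⟩
    · refine ⟨∑ b, ((v b : ℝ) / k) • realPoint P b, ?_, ?_⟩
      · refine hP.convex.sum_mem (fun b _ => by positivity) ?_ fun b _ => b.2
        rw [← Finset.sum_div, div_eq_one_iff_eq hk0.ne']
        exact_mod_cast hdegv
      · ext i
        simp only [Pi.smul_apply, Finset.sum_apply, smul_eq_mul, Finset.mul_sum, realPoint, toReal,
          exponentMap_apply, liftedPoint, Option.elim_some]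
        push_cast
        refine Finset.sum_congr rfl fun b _ => ?_
        field_simp
    · ext i
      have := congrFun hu (some i)
      rw [map_add, exponentMap_single] at this
      exact this

theorem exists_forall_affineMap_eq_sum [Fintype ι] (f : (ι → ℝ) →ᵃ[ℝ] ℝ) :
    ∃ G : Option ι → ℝ, ∀ a : latticePoints P,
      f (realPoint P a) = ∑ k, G k * liftedPoint P a k := by
  classical
  refine ⟨fun o => o.elim (f 0) fun i => f.linear (Pi.single i 1), fun a => ?_⟩
  rw [f.decomp, Pi.add_apply, f.linear.pi_apply_eq_sum_univ, Fintype.sum_option]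
  have h2 : ∀ i : ι, (fun j => if i = j then (1 : ℝ) else 0) = Pi.single i 1 := fun i => by
    ext j
    simp [Pi.single_apply, eq_comm]
  simp [liftedPoint, realPoint, toReal, mul_comm, add_comm, h2]

end Polytope

/-! ### The regular unimodular triangulation -/

section Triangulation

variable {ι : Type} [Fintype ι] {P : Set (ι → ℝ)} [Fintype (latticePoints P)]
  {ord : MonomialOrder.{0, 0} (latticePoints P)}

/-- The triangulation whose simplices are the supports of the standard exponent vectors. -/
noncomputable def standardTriangulation
    (H : StandardOfSupport ord (exponentMap (liftedPoint P))) :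
    Geometry.SimplicialComplex ℝ (ι → ℝ) where
  faces := {s | s.Nonempty ∧ ∃ u, IsStandard ord (exponentMap (liftedPoint P)) u ∧
    (s : Set (ι → ℝ)) = realPoint P '' u.support}
  isRelLowerSet_faces := by
    classical
    rintro s ⟨hs, u, hu, hsu⟩
    refine ⟨hs, fun t hts ht => ⟨ht, Finsupp.indicator
      (u.support.filter fun a => realPoint P a ∈ t) fun _ _ => 1, H u _ hu ?_, ?_⟩⟩
    · intro a ha
      rw [Finsupp.mem_support_iff, Finsupp.indicator_apply] at ha
      by_contra h
      simp [Finsupp.notMem_support_iff.1 h] at ha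
    · ext x
      constructor
      · intro hx
        obtain ⟨a, ha, rfl⟩ := hsu ▸ (Finset.coe_subset.2 hts hx)
        refine ⟨a, ?_, rfl⟩
        rw [Finset.mem_coe, Finsupp.mem_support_iff, Finsupp.indicator_apply,
          dif_pos (Finset.mem_filter.2 ⟨ha, hx⟩)]
        exact one_ne_zero
      · rintro ⟨a, ha, rfl⟩
        rw [Finset.mem_coe, Finsupp.mem_support_iff, Finsupp.indicator_apply] at ha
        by_contra h
        exact ha (dif_neg fun (h' : a ∈ u.support.filter _) => h (Finset.mem_filter.1 h').2)
  indep := by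
    classical
    rintro s ⟨-, u, hu, hsu⟩
    -- Affine independence of the vertices is linear independence of their lifts to height one.
    have h1 : AffineIndependent ℝ fun a : u.support => realPoint P a := by
      rw [affineIndependent_iff]
      intro t w hw hwt i hi
      let c : latticePoints P → ℝ := fun a => ∑ j ∈ t, if (j : latticePoints P) = a then w j else 0
      have hc : ∀ g : latticePoints P → ℝ, ∑ a, c a * g a = ∑ j ∈ t, w j * g j := fun g => by
        simp only [c, Finset.sum_mul]
        rw [Finset.sum_comm]
        simp
      have h2 : c i = 0 := by
        refine eq_zero_of_sum_mul_eq_zero H hu (fun a ha => ?_) (fun k => ?_) i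
        · exact Finset.sum_eq_zero fun j _ => if_neg fun (h : (j : latticePoints P) = a) =>
            ha (h ▸ j.2)
        · rw [hc fun a => (liftedPoint P a k : ℝ)]
          rcases k with _ | k
          · simpa [liftedPoint] using hw
          · have := congrFun hwt k
            simpa [liftedPoint, realPoint, toReal] using this
      simpa [c, Subtype.coe_inj, Finset.sum_ite_eq', hi] using h2
    have h2 := h1.range
    have h3 : Set.range (fun a : u.support => realPoint P a) = s := by
      rw [hsu]
      ext x
      simp
    rw [h3] at h2
    exact h2
  inter_subset_convexHull := by
    rintro s t ⟨-, u, hu, hsu⟩ ⟨-, v, hv, htv⟩ x ⟨hxs, hxt⟩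
    rw [hsu, mem_convexHull_toReal_iff] at hxs
    rw [htv, mem_convexHull_toReal_iff] at hxt
    obtain ⟨c, hc, hcu, hcx⟩ := hxs
    obtain ⟨c', hc', hcv, hcx'⟩ := hxt
    rw [hsu, htv, ← Set.image_inter (realPoint_injective P),
      mem_convexHull_toReal_iff]
    refine ⟨c', hc', fun a ha => ?_, hcx'⟩
    by_cases hav : a ∈ v.support
    · exact eq_zero_of_sum_mul_eq_sum_mul H hu hv hc' hc hcu hcv
        (fun k => (hcx k).trans (hcx' k).symm) fun hau => ha ⟨hau, hav⟩
    · exact hcv a hav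

theorem isLatticeTriangulation_standardTriangulation (hP : IsLatticePolytope P)
    (H : StandardOfSupport ord (exponentMap (liftedPoint P))) :
    IsLatticeTriangulation P (standardTriangulation H) := by
  refine ⟨Set.Subset.antisymm (fun x hx => ?_) (fun x hx => ?_), fun x hx => ?_⟩
  · obtain ⟨s, ⟨-, u, -, hsu⟩, hxs⟩ := Geometry.SimplicialComplex.mem_space_iff.1 hx
    refine convexHull_min ?_ hP.convex hxs
    rw [hsu]
    rintro _ ⟨a, -, rfl⟩
    exact a.2
  · classical
    rw [hP.eq_convexHull, ← Set.image_univ, mem_convexHull_toReal_iff] at hx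
    obtain ⟨c, hc, -, hcx⟩ := hx
    obtain ⟨w, hw⟩ := exists_weight H
    obtain ⟨y, u, hy, hu, hyu, hyc⟩ :=
      exists_standard_representation hw (k₀ := none) (fun _ => rfl) hc
    refine Geometry.SimplicialComplex.mem_space_iff.2
      ⟨u.support.image (realPoint P), ⟨?_, u, hu, by simp⟩, ?_⟩
    · rw [Finset.image_nonempty, Finset.nonempty_iff_ne_empty]
      intro h
      have h1 := (hyc none).trans (hcx none)
      simp [hyu _ (h ▸ Finset.notMem_empty _)] at h1
    · rw [Finset.coe_image, mem_convexHull_toReal_iff]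
      exact ⟨y, hy, hyu, fun k => (hyc k).trans (hcx k)⟩
  · obtain ⟨-, u, -, hu⟩ := Geometry.SimplicialComplex.mem_vertices.1 hx
    obtain ⟨a, -, rfl⟩ := hu ▸ (show x ∈ (({x} : Finset (ι → ℝ)) : Set (ι → ℝ)) by simp)
    exact ⟨a, a.2, rfl⟩

theorem isRegular_standardTriangulation
    (H : StandardOfSupport ord (exponentMap (liftedPoint P))) :
    IsRegular P (standardTriangulation H) := by
  classical
  obtain ⟨w, hw⟩ := exists_weight H
  refine ⟨fun a => if h : a ∈ latticePoints P then (w ⟨a, h⟩ : ℝ) else 0, fun s => ?_⟩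
  constructor
  · rintro ⟨hs, u, hu, hsu⟩
    refine ⟨hs, ?_, ?_⟩
    · rw [hsu]
      rintro _ ⟨a, -, rfl⟩
      exact ⟨a, a.2, rfl⟩
    obtain ⟨F, hF⟩ := exists_contact_functional H hw hu
    refine ⟨(∑ i, (F (some i) : ℝ) • (LinearMap.proj i : (ι → ℝ) →ₗ[ℝ] ℝ)).toAffineMap +
      AffineMap.const ℝ (ι → ℝ) (F none : ℝ), fun a ha => ?_⟩
    have h1 : ((∑ i, (F (some i) : ℝ) • (LinearMap.proj i : (ι → ℝ) →ₗ[ℝ] ℝ)).toAffineMap +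
      AffineMap.const ℝ (ι → ℝ) (F none : ℝ)) (toReal a) =
        ((∑ k, F k * liftedPoint P ⟨a, ha⟩ k : ℚ) : ℝ) := by
      rw [Fintype.sum_option]
      simp [liftedPoint, toReal, add_comm]
    simp only [h1, dif_pos ha, Rat.cast_le, Rat.cast_inj]
    have h2 : toReal a ∈ s ↔ (⟨a, ha⟩ : latticePoints P) ∈ u.support := by
      rw [← Finset.mem_coe, hsu]
      exact (realPoint_injective P).mem_set_image
        (s := (u.support : Set (latticePoints P))) (a := ⟨a, ha⟩)
    rw [h2]
    by_cases hau : (⟨a, ha⟩ : latticePoints P) ∈ u.support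
    · have h3 := (hF _).1 hau
      exact ⟨h3.le, iff_of_true h3 hau⟩
    · have h3 := (hF _).2 hau
      exact ⟨h3.le, iff_of_false h3.ne hau⟩
  · rintro ⟨hs, hsP, f, hf⟩
    have hf' : ∀ a : latticePoints P, f (realPoint P a) ≤ w a ∧
        (f (realPoint P a) = w a ↔ realPoint P a ∈ s) := fun a => by
      simpa using! hf a a.2
    let u : latticePoints P →₀ ℕ :=
      Finsupp.indicator (Finset.univ.filter fun a => realPoint P a ∈ s) fun _ _ => 1
    have hu : ∀ a, u a = if realPoint P a ∈ s then 1 else 0 := fun a => by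
      simp [u, Finsupp.indicator_apply]
    refine ⟨hs, u, ?_, ?_⟩
    -- The affine function has equal totals on `u` and `v`, is at most the weight on `v`, and equals
    -- it on `u`. So `v` cannot be lighter than `u`, as it would be were `u` nonstandard.
    · obtain ⟨v, hvπ, hvs, -⟩ := exists_isStandard ord (exponentMap (liftedPoint P)) u
      by_contra hne
      have hlt := hw v u hvs hvπ.symm fun h => hne (h ▸ hvs)
      obtain ⟨G, hG⟩ := exists_forall_affineMap_eq_sum (P := P) f
      have hval : ∀ v : latticePoints P →₀ ℕ, ∑ a, f (realPoint P a) * v a =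
          ∑ k, G k * exponentMap (liftedPoint P) v k := fun v => by
        simp only [hG, exponentMap_apply, Int.cast_sum, Finset.mul_sum, Finset.sum_mul]
        rw [Finset.sum_comm]
        refine Finset.sum_congr rfl fun k _ => Finset.sum_congr rfl fun a _ => ?_
        push_cast
        ring
      have h1 : ∑ a, (w a : ℝ) * u a = ∑ a, f (realPoint P a) * u a := by
        refine Finset.sum_congr rfl fun a _ => ?_
        by_cases ha : realPoint P a ∈ s
        · rw [(hf' a).2.2 ha]
        · rw [hu, if_neg ha]; simp
      have h2 : ∑ a, f (realPoint P a) * v a ≤ ∑ a, (w a : ℝ) * v a :=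
        Finset.sum_le_sum fun a _ => mul_le_mul_of_nonneg_right (hf' a).1 (Nat.cast_nonneg _)
      have h3 : ∑ a, (w a : ℝ) * v a < ∑ a, (w a : ℝ) * u a := by exact_mod_cast hlt
      rw [hval, hvπ, ← hval] at h2
      linarith
    · ext x
      constructor
      · intro hx
        obtain ⟨a, ha, rfl⟩ := hsP hx
        refine ⟨⟨a, ha⟩, ?_, rfl⟩
        rw [Finset.mem_coe, Finsupp.mem_support_iff, hu]
        exact (if_pos hx).trans_ne one_ne_zero
      · rintro ⟨a, ha, rfl⟩
        rw [Finset.mem_coe, Finsupp.mem_support_iff, hu] at ha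
        by_contra h
        exact ha (if_neg h)

/-- The real affine coefficients of a lattice point in the span of a simplex are integers by
`exists_int_coefficients`. -/
theorem isUnimodular_standardTriangulation (hlat : liftedLattice P = ⊤)
    (H : StandardOfSupport ord (exponentMap (liftedPoint P))) :
    IsUnimodular (standardTriangulation H) := by
  classical
  rintro s ⟨-, u, hu, hsu⟩ a ha
  rw [hsu] at ha
  obtain ⟨t, w, htu, hw, hat⟩ := eq_affineCombination_of_mem_affineSpan_image ha
  rw [Finset.affineCombination_eq_linear_combination _ _ _ hw] at hat
  let c : latticePoints P → ℝ := fun b => if b ∈ t then w b else (0 : ℝ)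
  have hcu : ∀ b, b ∉ u.support → c b = 0 := fun b hb => if_neg fun h => hb (htu h)
  have hc : ∀ k, ∑ b, c b * (liftedPoint P b k : ℝ) = (k.elim 1 (toReal a) : ℝ) := by
    rw [← sum_smul_toReal_eq_iff]
    constructor
    · simp [c, Finset.sum_ite_mem, hw]
    · simp [c, ite_smul, Finset.sum_ite_mem, hat]
  obtain ⟨n, hn⟩ := exists_sum_mul_liftedPoint hlat fun o => o.elim (1 : ℤ) a
  obtain ⟨z, hz⟩ := exists_int_coefficients H hu hcu (n := n) fun k => by
    rw [hc, hn]
    rcases k with _ | i <;> simp [toReal]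
  have h1 : (toReal a, (1 : ℝ)) = ∑ b ∈ u.support, z b • (realPoint P b, (1 : ℝ)) := by
    obtain ⟨h2, h3⟩ := sum_smul_toReal_eq_iff.2 hc
    rw [Finset.sum_subset (Finset.subset_univ _) fun b _ hb => ?_]
    · refine Prod.ext ?_ ?_
      · rw [Prod.fst_sum, ← h3]
        refine Finset.sum_congr rfl fun b _ => ?_
        rw [hz, Prod.smul_fst, Int.cast_smul_eq_zsmul]
      · rw [Prod.snd_sum]
        simp only [hz] at h2
        simpa [eq_comm] using h2
    · have : z b = 0 := by
        have := hcu b hb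
        rw [hz] at this
        exact_mod_cast this
      rw [this, zero_smul]
  rw [h1]
  refine AddSubgroup.sum_mem _ fun b hb => AddSubgroup.zsmul_mem _ (AddSubgroup.subset_closure ?_) _
  exact ⟨_, hsu ▸ ⟨b, hb, rfl⟩, rfl⟩

end Triangulation

/-- Sturmfels: a squarefree initial ideal of the toric ideal gives a regular unimodular
triangulation and the integer decomposition property. -/
theorem regularUnimodularTriangulation_and_isIDP {K : Type*} [Field K] {ι : Type} [Fintype ι]
    {P : Set (ι → ℝ)} (hP : IsLatticePolytope P) (hlat : liftedLattice P = ⊤) {l : ℕ}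
    (h : HasSquarefreeInitialIdeal (toricIdeal K P) l) :
    HasRegularUnimodularTriangulation P ∧ IsIDP P := by
  have : Fintype (latticePoints P) := hP.finite_latticePoints.fintype
  obtain ⟨ord, hord⟩ := (hasSquarefreeInitialIdeal_toricIdeal_iff P l).1 h
  have H := (hord.congr (toricExponent_eq_iff P)).standardOfSupport
  exact ⟨⟨standardTriangulation H, isLatticeTriangulation_standardTriangulation hP H,
    isRegular_standardTriangulation H, isUnimodular_standardTriangulation hlat H⟩,
    hP.isIDP hlat H⟩

/-! ### Refining a monomial order by a weight -/

section Refine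

variable {σ : Type} {Γ : Type*} [AddCommMonoid Γ] [LinearOrder Γ] [IsOrderedCancelAddMonoid Γ]
  [WellFoundedLT Γ]

/-- A copy of the exponent vectors, to be endowed with another order. -/
def Exponents (σ : Type) : Type := σ →₀ ℕ

noncomputable instance : AddCommMonoid (Exponents σ) := inferInstanceAs (AddCommMonoid (σ →₀ ℕ))

/-- The monomial order that compares the values of `f` first and breaks ties by `ord`. -/
noncomputable def refineOrder (f : (σ →₀ ℕ) →+ Γ) (hf : ∀ u, 0 ≤ f u)
    (ord : MonomialOrder.{0, 0} σ) : MonomialOrder.{0, 0} σ :=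
  let g : (σ →₀ ℕ) → Γ ×ₗ ord.syn := fun u => toLex (f u, ord.toSyn u)
  have hg : Function.Injective g := fun u v h =>
    ord.toSyn.injective (congrArg Prod.snd (toLex.injective h))
  have hadd : ∀ u v, g (u + v) = g u + g v := fun u v => by
    simp only [g, map_add]; rfl
  letI : LinearOrder (Exponents σ) := LinearOrder.lift' g hg
  { syn := Exponents σ
    linearOrderSyn := inferInstance
    addCommMonoidSyn := inferInstance
    isOrderedAddMonoid_syn :=
      { add_le_add_left := fun u v h w => by
          have h1 := add_le_add_left (show g u ≤ g v from h) (g w)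
          exact (hadd u w).trans_le (h1.trans_eq (hadd v w).symm) }
    toSyn := AddEquiv.refl (σ →₀ ℕ)
    toSyn_monotone := fun u v h => by
      obtain ⟨d, rfl⟩ := exists_add_of_le h
      change g u ≤ g (u + d)
      rw [hadd]
      refine le_add_of_nonneg_right (Prod.Lex.le_iff.2 ?_)
      rcases (hf d).lt_or_eq with h0 | h0
      · exact Or.inl h0
      · exact Or.inr ⟨h0, ord.zero_le _⟩
    wellFoundedLT_syn := ⟨InvImage.wf g (wellFounded_lt (α := Γ ×ₗ ord.syn))⟩ }

theorem refineOrder_lt_iff (f : (σ →₀ ℕ) →+ Γ) (hf : ∀ u, 0 ≤ f u)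
    (ord : MonomialOrder.{0, 0} σ) (u v : σ →₀ ℕ) :
    (refineOrder f hf ord).toSyn u < (refineOrder f hf ord).toSyn v ↔
      f u < f v ∨ f u = f v ∧ ord.toSyn u < ord.toSyn v :=
  Prod.Lex.lt_iff (x := toLex (f u, ord.toSyn u)) (y := toLex (f v, ord.toSyn v))

theorem nonempty_monomialOrder (σ : Type) [Finite σ] : Nonempty (MonomialOrder.{0, 0} σ) := by
  obtain ⟨n, ⟨e⟩⟩ := Finite.exists_equiv_fin σ
  let _ : LinearOrder σ := LinearOrder.lift' e e.injective
  exact ⟨MonomialOrder.lex⟩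

end Refine

/-! ### Tuples with one entry of each type -/

section Tuples

variable {C : Type} {m : ℕ} {ty : C → Fin m} {G : Type*} [AddCommGroup G]
  {val : C → G}

/-- The exponent vector of a tuple. -/
noncomputable def tuple (t : Fin m → C) : C →₀ ℕ := ∑ i, Finsupp.single (t i) 1

/-- The map recording the value and the number of entries of each type of an exponent vector. -/
noncomputable def typedMap (ty : C → Fin m) (val : C → G) : (C →₀ ℕ) →+ G × (Fin m → ℕ) :=
  natCombination fun c => (val c, Pi.single (ty c) 1)

open scoped Classical in
theorem tuple_apply {t : Fin m → C} (ht : ∀ i, ty (t i) = i) (c : C) :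
    tuple t c = if t (ty c) = c then 1 else 0 := by
  simp only [tuple, Finsupp.coe_finsetSum, Finset.sum_apply, Finsupp.single_apply]
  rw [Finset.sum_eq_single (ty c)]
  · intro i _ hi
    exact if_neg fun h => hi (by rw [← h, ht])
  · simp

theorem tuple_injective {t t' : Fin m → C} (ht : ∀ i, ty (t i) = i) (ht' : ∀ i, ty (t' i) = i)
    (h : tuple t = tuple t') : t = t' := by
  ext i
  have := DFunLike.congr_fun h (t i)
  rw [tuple_apply ht, tuple_apply ht', ht, if_pos rfl] at this
  by_contra hne
  rw [if_neg (Ne.symm hne)] at this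
  exact one_ne_zero this

theorem typedMap_tuple {t : Fin m → C} (ht : ∀ i, ty (t i) = i) :
    typedMap ty val (tuple t) = (∑ i, val (t i), fun _ => 1) := by
  simp only [tuple, map_sum, typedMap, natCombination_single, one_smul, ht]
  refine Prod.ext (by simp [Prod.fst_sum]) ?_
  ext j
  simp [Prod.snd_sum, Finset.sum_apply, Pi.single_apply]

open scoped Classical in
theorem typedMap_snd [Fintype C] (u : C →₀ ℕ) (i : Fin m) :
    (typedMap ty val u).2 i = ∑ c, if ty c = i then u c else 0 := by
  simp [typedMap, natCombination_apply, Prod.snd_sum, Finset.sum_apply, Pi.single_apply, eq_comm]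

theorem eq_zero_of_typedMap_snd_eq_zero [Fintype C] {u : C →₀ ℕ} (h : (typedMap ty val u).2 = 0) : u = 0 := by
  classical
  ext c
  have h1 := congrFun h (ty c)
  rw [typedMap_snd, Pi.zero_apply, Finset.sum_eq_zero_iff] at h1
  simpa using h1 c (Finset.mem_univ c)

theorem exists_tuple_le [Fintype C] {u : C →₀ ℕ} (h : ∀ i, (typedMap ty val u).2 i ≠ 0) :
    ∃ t : Fin m → C, (∀ i, ty (t i) = i) ∧ tuple t ≤ u := by
  classical
  have h1 : ∀ i, ∃ c, ty c = i ∧ u c ≠ 0 := fun i => by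
    by_contra! h2
    refine h i ?_
    rw [typedMap_snd]
    refine Finset.sum_eq_zero fun c _ => ?_
    split_ifs with hc
    · exact h2 c hc
    · rfl
  choose t ht htu using h1
  refine ⟨t, ht, fun c => ?_⟩
  rw [tuple_apply ht]
  split_ifs with hc
  · rw [← hc, Nat.one_le_iff_ne_zero]; exact htu _
  · exact Nat.zero_le _

/-- A tuple fits below `u` and already exhausts all type counts, so nothing remains. -/
theorem exists_eq_tuple [Fintype C] {u : C →₀ ℕ} {g : G} (h : typedMap ty val u = (g, fun _ => 1)) :
    ∃ t : Fin m → C, (∀ i, ty (t i) = i) ∧ u = tuple t := by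
  obtain ⟨t, ht, hle⟩ := exists_tuple_le (u := u) (ty := ty) (val := val) (by simp [h])
  obtain ⟨d, rfl⟩ := exists_add_of_le hle
  refine ⟨t, ht, ?_⟩
  have h1 : (typedMap ty val d).2 = 0 := by
    have := congrArg Prod.snd h
    rw [map_add, typedMap_tuple ht, Prod.snd_add] at this
    exact add_eq_left.1 this
  rw [eq_zero_of_typedMap_snd_eq_zero h1, add_zero]

end Tuples

/-! ### Transfer of standardness to sums of tuples -/

section Combinatorics

variable {C B : Type} {m : ℕ} {ty : C → Fin m} {G : Type*}
  [AddCommGroup G] {val : C → G} {valB : B → G} {ord : MonomialOrder.{0, 0} C} {c : B → Fin m → C}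

/-- A choice, for every point `b`, of a standard tuple with value `b`; all standard tuples occur. -/
structure IsStandardDecomposition (ord : MonomialOrder.{0, 0} C) (ty : C → Fin m) (val : C → G)
    (valB : B → G) (c : B → Fin m → C) : Prop where
  injective : Function.Injective valB
  type_eq : ∀ b i, ty (c b i) = i
  sum_eq : ∀ b, ∑ i, val (c b i) = valB b
  isStandard : ∀ b, IsStandard ord (typedMap ty val) (tuple (c b))
  exists_eq : ∀ t : Fin m → C, (∀ i, ty (t i) = i) →
    IsStandard ord (typedMap ty val) (tuple t) → ∃ b, c b = t

/-- The standard vector in the fibre of a tuple has one entry of each type, hence is a tuple again;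
uniqueness of standard vectors shows that every standard tuple gets chosen. -/
theorem exists_isStandardDecomposition [Fintype C] (ord : MonomialOrder.{0, 0} C)
    (hB : Function.Injective valB)
    (hdec : ∀ b, ∃ t : Fin m → C, (∀ i, ty (t i) = i) ∧ ∑ i, val (t i) = valB b)
    (hsum : ∀ t : Fin m → C, (∀ i, ty (t i) = i) → ∃ b, valB b = ∑ i, val (t i)) :
    ∃ c : B → Fin m → C, IsStandardDecomposition ord ty val valB c := by
  have key : ∀ b, ∃ t : Fin m → C, (∀ i, ty (t i) = i) ∧ ∑ i, val (t i) = valB b ∧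
      IsStandard ord (typedMap ty val) (tuple t) := by
    intro b
    obtain ⟨t, ht, htb⟩ := hdec b
    obtain ⟨u, hu, hus, -⟩ := exists_isStandard ord (typedMap ty val) (tuple t)
    rw [typedMap_tuple ht] at hu
    obtain ⟨t', ht', rfl⟩ := exists_eq_tuple hu
    rw [typedMap_tuple ht'] at hu
    exact ⟨t', ht', (congrArg Prod.fst hu).trans htb, hus⟩
  choose c hc1 hc2 hc3 using key
  refine ⟨c, hB, hc1, hc2, hc3, fun t ht hts => ?_⟩
  obtain ⟨b, hb⟩ := hsum t ht
  refine ⟨b, tuple_injective (hc1 b) ht ((hc3 b).eq hts ?_)⟩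
  rw [typedMap_tuple (hc1 b), typedMap_tuple ht, hc2, hb]

/-- The map on exponent vectors that replaces every point by its standard tuple. -/
noncomputable def tupleMap (c : B → Fin m → C) : (B →₀ ℕ) →+ (C →₀ ℕ) :=
  natCombination fun b => tuple (c b)

theorem tupleMap_single (c : B → Fin m → C) (b : B) :
    tupleMap c (Finsupp.single b 1) = tuple (c b) := by
  rw [tupleMap, natCombination_single, one_smul]

namespace IsStandardDecomposition

variable (hc : IsStandardDecomposition ord ty val valB c)

include hc

theorem injective' : Function.Injective c := fun b b' h =>
  hc.injective (by rw [← hc.sum_eq, ← hc.sum_eq, h])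

theorem typedMap_tupleMap (v : B →₀ ℕ) :
    typedMap ty val (tupleMap c v) =
      ((natCombination (fun b => (valB b, 1)) v).1,
        fun _ => (natCombination (fun b => (valB b, (1 : ℕ))) v).2) := by
  induction v using Finsupp.induction_linear with
  | zero => simp; rfl
  | add u v hu hv => rw [map_add, map_add, hu, hv, map_add]; rfl
  | single b n =>
    rw [tupleMap, natCombination_single, natCombination_single, map_nsmul,
      typedMap_tuple (hc.type_eq b), hc.sum_eq]
    rfl

/-- Every type is counted once per point, so any single type count, available as `m > 0`, recovers
the degree. -/
theorem typedMap_tupleMap_eq_iff (hm : 0 < m) (v v' : B →₀ ℕ) :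
    typedMap ty val (tupleMap c v) = typedMap ty val (tupleMap c v') ↔
      natCombination (fun b => (valB b, (1 : ℕ))) v =
        natCombination (fun b => (valB b, (1 : ℕ))) v' := by
  rw [hc.typedMap_tupleMap, hc.typedMap_tupleMap]
  constructor
  · intro h
    exact Prod.ext (Prod.ext_iff.1 h).1 (congrFun (Prod.ext_iff.1 h).2 ⟨0, hm⟩)
  · intro h
    rw [h]

theorem eq_zero_of_tupleMap_eq_zero [Fintype B] (hm : 0 < m) {v : B →₀ ℕ} (h : tupleMap c v = 0) : v = 0 := by
  have h1 := congrFun (congrArg Prod.snd (hc.typedMap_tupleMap v)) ⟨0, hm⟩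
  rw [h, map_zero, natCombination_apply, Prod.snd_sum] at h1
  ext b
  have h2 := (Finset.sum_eq_zero_iff.1 h1.symm) b (Finset.mem_univ b)
  simpa using h2

theorem tupleMap_apply_ne_zero_iff [Fintype B] (v : B →₀ ℕ) (x : C) :
    tupleMap c v x ≠ 0 ↔ ∃ b ∈ v.support, c b (ty x) = x := by
  classical
  rw [tupleMap, natCombination_apply, Finsupp.coe_finsetSum, Finset.sum_apply, Ne,
    Finset.sum_eq_zero_iff]
  simp [tuple_apply (hc.type_eq _), and_comm]

/-- Every standard exponent vector with equally many entries of each type comes from a sum of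
points. -/
theorem exists_tupleMap_eq [Fintype C] (k : ℕ) : ∀ u : C →₀ ℕ, IsStandard ord (typedMap ty val) u →
    ((typedMap ty val u).2 = fun _ => k) → ∃ v, tupleMap c v = u := by
  induction k with
  | zero => exact fun u _ hu => ⟨0, by rw [eq_zero_of_typedMap_snd_eq_zero hu, map_zero]⟩
  | succ k ih =>
    intro u hus hu
    obtain ⟨t, ht, hle⟩ := exists_tuple_le (u := u) (ty := ty) (val := val) (by simp [hu])
    -- A tuple below a standard vector is standard, so it is the chosen tuple of some point and can
    -- be peeled off.
    obtain ⟨b, hb⟩ := hc.exists_eq t ht (hus.of_le hle)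
    obtain ⟨d, rfl⟩ := exists_add_of_le hle
    obtain ⟨v, hv⟩ := ih d (hus.of_le le_add_self) (by
      ext i
      have := congrFun hu i
      rw [map_add, typedMap_tuple ht] at this
      simp only [Prod.snd_add, Pi.add_apply] at this
      omega)
    exact ⟨Finsupp.single b 1 + v, by rw [map_add, tupleMap_single, hb, hv]⟩

end IsStandardDecomposition

/-- The entrywise order on points via their standard tuples. -/
def TupleLE (idx : C → ℕ) (c : B → Fin m → C) (b b' : B) : Prop :=
  ∀ i, idx (c b i) ≤ idx (c b' i)

/-- The points in the support of the exponent vector are pairwise comparable. -/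
def IsTupleChain (idx : C → ℕ) (c : B → Fin m → C) (v : B →₀ ℕ) : Prop :=
  ∀ b ∈ v.support, ∀ b' ∈ v.support, TupleLE idx c b b' ∨ TupleLE idx c b' b

variable {idx : C → ℕ}

theorem IsTupleChain.exists_least {v : B →₀ ℕ} (h : IsTupleChain idx c v) (hv : v ≠ 0) :
    ∃ b ∈ v.support, ∀ b' ∈ v.support, TupleLE idx c b b' := by
  obtain ⟨b, hb, hmin⟩ := v.support.exists_min_image (fun b => ∑ i, idx (c b i))
    (Finsupp.support_nonempty_iff.2 hv)
  refine ⟨b, hb, fun b' hb' => ?_⟩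
  rcases h b hb b' hb' with h1 | h1
  · exact h1
  · have h2 := (Finset.sum_eq_sum_iff_of_le fun i _ => h1 i).1
      (le_antisymm (Finset.sum_le_sum fun i _ => h1 i) (hmin b' hb'))
    exact fun i => (h2 i (Finset.mem_univ i)).ge

theorem IsTupleChain.mono {u v : B →₀ ℕ} (h : IsTupleChain idx c v) (huv : u.support ⊆ v.support) :
    IsTupleChain idx c u := fun b hb b' hb' => h b (huv hb) b' (huv hb')

/-- A chain is determined by its image in the exponent vectors of the Cayley sum. -/
theorem IsStandardDecomposition.eq_of_tupleMap_eq [Fintype B] (hc : IsStandardDecomposition ord ty val valB c)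
    (hm : 0 < m) (hidx : Function.Injective idx) (n : ℕ) :
    ∀ v v' : B →₀ ℕ, v.degree = n → IsTupleChain idx c v → IsTupleChain idx c v' →
      tupleMap c v = tupleMap c v' → v = v' := by
  induction n with
  | zero =>
    intro v v' hn _ _ h
    rw [Finsupp.degree_eq_zero_iff] at hn
    subst hn
    rw [map_zero] at h
    exact (hc.eq_zero_of_tupleMap_eq_zero hm h.symm).symm
  | succ n ih =>
    intro v v' hn hv hv' h
    have hv0 : v ≠ 0 := by rintro rfl; simp at hn
    have hv0' : v' ≠ 0 := by
      rintro rfl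
      rw [map_zero] at h
      exact hv0 (hc.eq_zero_of_tupleMap_eq_zero hm h)
    -- Each entry of `b` occurs in the common image, hence in some point of `v'`, and so is bounded
    -- below by the entry of the least point. Thus the two chains share their least point, which is
    -- cancelled.
    have key : ∀ {v v' : B →₀ ℕ} {b b' : B}, b ∈ v.support →
        (∀ x ∈ v'.support, TupleLE idx c b' x) → tupleMap c v = tupleMap c v' →
        TupleLE idx c b' b := by
      intro v v' b b' hb hle h i
      have h1 : tupleMap c v (c b i) ≠ 0 :=
        (hc.tupleMap_apply_ne_zero_iff v _).2 ⟨b, hb, by rw [hc.type_eq]⟩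
      rw [h, hc.tupleMap_apply_ne_zero_iff, hc.type_eq] at h1
      obtain ⟨x, hx, hxi⟩ := h1
      rw [← hxi]
      exact hle x hx i
    obtain ⟨b, hb, hbmin⟩ := hv.exists_least hv0
    obtain ⟨b', hb', hbmin'⟩ := hv'.exists_least hv0'
    obtain rfl : b = b' := hc.injective' (funext fun i =>
      hidx (le_antisymm (key hb' hbmin h.symm i) (key hb hbmin' h i)))
    have hle : ∀ {w : B →₀ ℕ}, b ∈ w.support → Finsupp.single b 1 ≤ w := fun hw =>
      Finsupp.single_le_iff.2 (Nat.one_le_iff_ne_zero.2 (Finsupp.mem_support_iff.1 hw))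
    obtain ⟨d, rfl⟩ := exists_add_of_le (hle hb)
    obtain ⟨d', rfl⟩ := exists_add_of_le (hle hb')
    rw [map_add, map_add] at h
    rw [ih d d' (by simp at hn; omega) (hv.mono (Finsupp.support_mono le_add_self))
      (hv'.mono (Finsupp.support_mono le_add_self)) (add_left_cancel h)]

theorem single_add_single_le {b b' : B} (hne : b ≠ b') {v : B →₀ ℕ} (hb : b ∈ v.support)
    (hb' : b' ∈ v.support) : Finsupp.single b 1 + Finsupp.single b' 1 ≤ v := by
  classical
  intro x
  rw [Finsupp.mem_support_iff] at hb hb'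
  rw [Finsupp.add_apply, Finsupp.single_apply, Finsupp.single_apply]
  split_ifs with h1 h2 h2
  · exact absurd (h1.trans h2.symm) hne
  · subst h1; omega
  · subst h2; omega
  · exact Nat.zero_le _

/-- The weight that is smaller on more spread out sums of points. -/
noncomputable def spreadWeight [Fintype B] (idx : C → ℕ) (c : B → Fin m → C) : (B →₀ ℕ) →+ ℕ :=
  -- The constant dominates each square, so the truncated subtraction is exact. In a fixed degree, a
  -- larger sum of squares means a smaller weight.
  natCombination fun b => ∑ b', (∑ i, idx (c b' i)) ^ 2 - (∑ i, idx (c b i)) ^ 2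

/-- The monomial order that compares standard tuples first and then prefers spread out sums. -/
noncomputable def minkowskiOrder [Fintype B] (ord : MonomialOrder.{0, 0} C) (idx : C → ℕ) (c : B → Fin m → C)
    (ord₀ : MonomialOrder.{0, 0} B) : MonomialOrder.{0, 0} B :=
  refineOrder (ord.toSyn.toAddMonoidHom.comp (tupleMap c)) (fun _ => ord.zero_le _)
    (refineOrder (spreadWeight idx c) (fun _ => Nat.zero_le _) ord₀)

theorem minkowskiOrder_lt_iff [Fintype B] (ord₀ : MonomialOrder.{0, 0} B) (u v : B →₀ ℕ) :
    (minkowskiOrder ord idx c ord₀).toSyn u < (minkowskiOrder ord idx c ord₀).toSyn v ↔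
      ord.toSyn (tupleMap c u) < ord.toSyn (tupleMap c v) ∨
        tupleMap c u = tupleMap c v ∧ (spreadWeight idx c u < spreadWeight idx c v ∨
          spreadWeight idx c u = spreadWeight idx c v ∧ ord₀.toSyn u < ord₀.toSyn v) := by
  rw [minkowskiOrder, refineOrder_lt_iff, refineOrder_lt_iff]
  simp

namespace IsStandardDecomposition

variable (hc : IsStandardDecomposition ord ty val valB c) (ord₀ : MonomialOrder.{0, 0} B)

include hc

/-- The standard vector in the fibre of the image has equal type counts, so it comes from a sum of
points; that sum would win the first comparison of the order. -/
theorem isStandard_tupleMap [Fintype C] [Fintype B] (hm : 0 < m) {v : B →₀ ℕ}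
    (hv : IsStandard (minkowskiOrder ord idx c ord₀) (natCombination fun b => (valB b, (1 : ℕ))) v) :
    IsStandard ord (typedMap ty val) (tupleMap c v) := by
  by_contra hns
  obtain ⟨u, hu, hus, hle⟩ := exists_isStandard ord (typedMap ty val) (tupleMap c v)
  obtain ⟨v', rfl⟩ := hc.exists_tupleMap_eq _ u hus
    (by rw [hu, hc.typedMap_tupleMap])
  have hlt := lt_of_le_of_ne hle fun h => hns (ord.toSyn.injective h ▸ hus)
  exact not_isStandard_of_lt ((hc.typedMap_tupleMap_eq_iff hm _ _).1 hu)
    ((minkowskiOrder_lt_iff ord₀ _ _).2 (Or.inl hlt)) hv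

/-- Sort the entries of the two tuples into an entrywise minimum and maximum. Their sum is unchanged
and standard, so both are chosen tuples; by incomparability their index sums are farther apart with
the same total, which increases the sum of squares and wins the tie-break. -/
theorem not_isStandard_of_not_comparable [Fintype B] (hm : 0 < m) {b b' : B}
    (hs : IsStandard ord (typedMap ty val)
      (tupleMap c (Finsupp.single b 1 + Finsupp.single b' 1)))
    (h : ¬ TupleLE idx c b b') (h' : ¬ TupleLE idx c b' b) :
    ¬ IsStandard (minkowskiOrder ord idx c ord₀) (natCombination fun b => (valB b, (1 : ℕ)))
      (Finsupp.single b 1 + Finsupp.single b' 1) := by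
  classical
  let t : Fin m → C := fun i => if idx (c b i) ≤ idx (c b' i) then c b i else c b' i
  let t' : Fin m → C := fun i => if idx (c b i) ≤ idx (c b' i) then c b' i else c b i
  have ht : ∀ i, ty (t i) = i := fun i => by
    simp only [t]; split_ifs <;> exact hc.type_eq _ _
  have ht' : ∀ i, ty (t' i) = i := fun i => by
    simp only [t']; split_ifs <;> exact hc.type_eq _ _
  have htt : tuple t + tuple t' = tuple (c b) + tuple (c b') := by
    simp only [tuple, ← Finset.sum_add_distrib]
    refine Finset.sum_congr rfl fun i _ => ?_
    simp only [t, t']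
    split_ifs
    · rfl
    · rw [add_comm]
  rw [map_add, tupleMap_single, tupleMap_single, ← htt] at hs
  obtain ⟨x, hx⟩ := hc.exists_eq t ht (hs.of_le le_self_add)
  obtain ⟨y, hy⟩ := hc.exists_eq t' ht' (hs.of_le le_add_self)
  have hφ : tupleMap c (Finsupp.single x 1 + Finsupp.single y 1) =
      tupleMap c (Finsupp.single b 1 + Finsupp.single b' 1) := by
    simp only [map_add, tupleMap_single, hx, hy, htt]
  refine not_isStandard_of_lt (v := Finsupp.single x 1 + Finsupp.single y 1)
    ((hc.typedMap_tupleMap_eq_iff hm _ _).1 (by rw [hφ]))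
    ((minkowskiOrder_lt_iff ord₀ _ _).2 (Or.inr ⟨hφ, Or.inl ?_⟩))
  let s : B → ℕ := fun b => ∑ i, idx (c b i)
  let M : ℕ := ∑ b, s b ^ 2
  have hM : ∀ b, s b ^ 2 ≤ M := fun b =>
    Finset.single_le_sum (f := fun b => s b ^ 2) (fun _ _ => Nat.zero_le _) (Finset.mem_univ b)
  have hw : ∀ b, spreadWeight idx c (Finsupp.single b 1) = M - s b ^ 2 := fun b => by
    rw [spreadWeight, natCombination_single, one_smul]
  have hsum : s x + s y = s b + s b' := by
    simp only [s, ← Finset.sum_add_distrib, hx, hy, t, t']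
    refine Finset.sum_congr rfl fun i _ => ?_
    split_ifs
    · rfl
    · rw [add_comm]
  have hxb : s x < s b := by
    simp only [TupleLE, not_forall, not_le] at h
    obtain ⟨i, hi⟩ := h
    simp only [s, hx, t]
    refine Finset.sum_lt_sum (fun i _ => ?_) ⟨i, Finset.mem_univ i, ?_⟩
    · split_ifs with h1
      · exact le_rfl
      · exact (not_le.1 h1).le
    · rw [if_neg (not_le.2 hi)]; exact hi
  have hxb' : s x < s b' := by
    simp only [TupleLE, not_forall, not_le] at h'
    obtain ⟨i, hi⟩ := h'
    simp only [s, hx, t]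
    refine Finset.sum_lt_sum (fun i _ => ?_) ⟨i, Finset.mem_univ i, ?_⟩
    · split_ifs with h1
      · exact h1
      · exact le_rfl
    · rw [if_pos hi.le]; exact hi
  have hsq : s b ^ 2 + s b' ^ 2 < s x ^ 2 + s y ^ 2 := by
    obtain ⟨p, hp⟩ := Nat.exists_eq_add_of_lt hxb
    obtain ⟨q, hq⟩ := Nat.exists_eq_add_of_lt hxb'
    have hy : s y = s x + (p + 1) + (q + 1) := by omega
    rw [hp, hq, hy]
    nlinarith
  rw [map_add, map_add, hw, hw, hw, hw]
  have := hM x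
  have := hM y
  have := hM b
  have := hM b'
  omega

/-- The nonstandard exponent vectors of the Minkowski sum are multiples of squarefree ones of
degree at most `l`. -/
theorem isSquarefreeFibration [Fintype C] [Fintype B] (hm : 0 < m) (hidx : Function.Injective idx) {l : ℕ}
    (hS : IsSquarefreeFibration ord (typedMap ty val) l)
    (hl : 2 ≤ l ∨ ∀ x y, ty x = ty y → x = y) :
    IsSquarefreeFibration (minkowskiOrder ord idx c ord₀)
      (natCombination fun b => (valB b, (1 : ℕ))) l := by
  classical
  obtain ⟨S, hSsq, hSiff⟩ := hS
  -- All nonstandard squarefree vectors of degree at most `l` serve as generators; what matters is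
  -- that every nonstandard vector has one below it.
  refine ⟨{s | ((∀ b, s b ≤ 1) ∧ s.degree ≤ l) ∧ ¬ IsStandard (minkowskiOrder ord idx c ord₀)
    (natCombination fun b => (valB b, (1 : ℕ))) s}, fun s hs => hs.1, fun v =>
      ⟨fun hv => ?_, fun ⟨s, hs, hsv⟩ hv => hs.2 (hv.of_le hsv)⟩⟩
  by_cases hφ : IsStandard ord (typedMap ty val) (tupleMap c v)
  -- A chain with standard image is standard: the standard vector of its fibre is also a chain,
  -- since an incomparable pair would make it nonstandard, and has the same image.
  · have hchain : ¬ IsTupleChain idx c v := by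
      intro hch
      obtain ⟨u, hu, hus, -⟩ := exists_isStandard (minkowskiOrder ord idx c ord₀)
        (natCombination fun b => (valB b, (1 : ℕ))) v
      have huφ := hc.isStandard_tupleMap ord₀ hm hus
      have huch : IsTupleChain idx c u := by
        intro b hb b' hb'
        by_contra! hcon
        have hne : b ≠ b' := by rintro rfl; exact hcon.1 fun i => le_rfl
        have hle := single_add_single_le hne hb hb'
        obtain ⟨d, rfl⟩ := exists_add_of_le hle
        refine hc.not_isStandard_of_not_comparable ord₀ hm (huφ.of_le ?_) hcon.1 hcon.2
          (hus.of_le hle)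
        rw [map_add _ _ d]
        exact le_self_add
      have huv : u = v := hc.eq_of_tupleMap_eq hm hidx _ u v rfl huch hch
        (huφ.eq hφ ((hc.typedMap_tupleMap_eq_iff hm _ _).2 hu))
      exact hv (huv ▸ hus)
    simp only [IsTupleChain, not_forall, not_or] at hchain
    obtain ⟨b, hb, b', hb', h1, h2⟩ := hchain
    have hne : b ≠ b' := by rintro rfl; exact h1 fun i => le_rfl
    have hle := single_add_single_le hne hb hb'
    refine ⟨_, ⟨⟨fun x => ?_, ?_⟩,
      hc.not_isStandard_of_not_comparable ord₀ hm (hφ.of_le ?_) h1 h2⟩, hle⟩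
    · rw [Finsupp.add_apply, Finsupp.single_apply, Finsupp.single_apply]
      split_ifs with h3 h4
      · exact absurd (h3.trans h4.symm) hne
      all_goals simp
    · rw [map_add, Finsupp.degree_single, Finsupp.degree_single]
      rcases hl with hl | hl
      · exact hl
      · exact absurd (fun i => by rw [hl (c b i) (c b' i) (by rw [hc.type_eq, hc.type_eq])]) h1
    · obtain ⟨d, rfl⟩ := exists_add_of_le hle
      rw [map_add _ _ d]
      exact le_self_add
  · obtain ⟨s, hsS, hs⟩ := (hSiff _).1 hφ
    -- For each entry of the generator `s` choose a point of `v` whose tuple contains it. The chosen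
    -- points number at most `l`, and as `s` is squarefree their image still lies above `s`.
    have h1 : ∀ x : s.support, ∃ b ∈ v.support, c b (ty x) = x := fun x => by
      rw [← hc.tupleMap_apply_ne_zero_iff]
      have := hs x
      have := Finsupp.mem_support_iff.1 x.2
      omega
    choose f hfv hf using h1
    let A : Finset B := Finset.univ.image f
    let w : B →₀ ℕ := Finsupp.indicator A fun _ _ => 1
    have hw : ∀ b, w b = if b ∈ A then 1 else 0 := fun b => by simp [w, Finsupp.indicator_apply]
    refine ⟨w, ⟨⟨fun b => by rw [hw]; split_ifs <;> simp, ?_⟩, fun hws => ?_⟩, fun b => ?_⟩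
    · calc w.degree = A.card := by
            rw [Finsupp.degree_eq_sum]; simp [hw]
        _ ≤ Fintype.card s.support := Finset.card_image_le
        _ = ∑ x ∈ s.support, 1 := by rw [Fintype.card_coe, Finset.card_eq_sum_ones]
        _ ≤ s.degree := Finset.sum_le_sum fun x hx =>
            Nat.one_le_iff_ne_zero.2 (Finsupp.mem_support_iff.1 hx)
        _ ≤ l := (hSsq s hsS).2
    · refine (hSiff (tupleMap c w)).2 ⟨s, hsS, fun x => ?_⟩ (hc.isStandard_tupleMap ord₀ hm hws)
      by_cases hx : s x = 0
      · omega
      · have h2 : tupleMap c w x ≠ 0 := by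
          rw [hc.tupleMap_apply_ne_zero_iff]
          have hxs := Finsupp.mem_support_iff.2 hx
          refine ⟨f ⟨x, hxs⟩, ?_, hf ⟨x, hxs⟩⟩
          rw [Finsupp.mem_support_iff, hw, if_pos (Finset.mem_image_of_mem f (Finset.mem_univ _))]
          exact one_ne_zero
        have h3 := (hSsq s hsS).1 x
        omega
    · rw [hw]
      split_ifs with hb
      · obtain ⟨x, -, rfl⟩ := Finset.mem_image.1 hb
        exact Nat.one_le_iff_ne_zero.2 (Finsupp.mem_support_iff.1 (hfv x))
      · exact Nat.zero_le _

end IsStandardDecomposition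

end Combinatorics

/-! ### Lattice points and lattice of the Cayley sum -/

section Cayley

variable {d m : ℕ} {P : Fin m → Set (Fin d → ℝ)}

/-- The point of the Cayley sum over `x`, at the vertex number `i` of the simplex. -/
def cayleyPoint {R : Type*} [Zero R] [One R] (m : ℕ) (i : Fin m) (x : Fin d → R) :
    Fin d ⊕ Fin (m - 1) → R :=
  Sum.elim x fun j => if (j : ℕ) = (i : ℕ) then 1 else 0

theorem toReal_cayleyPoint (i : Fin m) (a : Fin d → ℤ) :
    toReal (cayleyPoint m i a) = cayleyPoint m i (toReal a) := by
  ext k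
  rcases k with k | k <;> simp [toReal, cayleyPoint]

theorem sum_smul_cayleyPoint {σ : Type*} (s : Finset σ) (i : Fin m) {c : σ → ℝ}
    (hc : ∑ a ∈ s, c a = 1) (p : σ → Fin d → ℝ) :
    ∑ a ∈ s, c a • cayleyPoint m i (p a) = cayleyPoint m i (∑ a ∈ s, c a • p a) := by
  ext k
  rcases k with k | k
  · simp [cayleyPoint]
  · simp [cayleyPoint, hc]

theorem cayleyPoint_mem_cayleySum {i : Fin m} {x : Fin d → ℝ} (hx : x ∈ P i) :
    cayleyPoint m i x ∈ cayleySum P :=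
  subset_convexHull ℝ _ (Set.mem_iUnion.2 ⟨i, x, hx, rfl⟩)

theorem cayleyPoint_mem_latticePoints {i : Fin m} {a : Fin d → ℤ} (ha : a ∈ latticePoints (P i)) :
    cayleyPoint m i a ∈ latticePoints (cayleySum P) := by
  rw [latticePoints, Set.mem_ofPred_eq, toReal_cayleyPoint]
  exact cayleyPoint_mem_cayleySum ha

theorem eq_of_forall_coordinate {i i' : Fin m}
    (h : ∀ j : Fin (m - 1), (j : ℕ) = (i : ℕ) ↔ (j : ℕ) = (i' : ℕ)) : i = i' := by
  by_cases hi : (i : ℕ) < m - 1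
  · exact Fin.ext ((h ⟨i, hi⟩).1 rfl)
  · by_cases hi' : (i' : ℕ) < m - 1
    · exact Fin.ext ((h ⟨i', hi'⟩).2 rfl).symm
    · ext; omega

theorem cayleyPoint_injective {i i' : Fin m} {a a' : Fin d → ℤ}
    (h : cayleyPoint m i a = cayleyPoint m i' a') : i = i' ∧ a = a' := by
  refine ⟨eq_of_forall_coordinate fun j => ?_, funext fun k => congrFun h (Sum.inl k)⟩
  have := congrFun h (Sum.inr j)
  simp only [cayleyPoint, Sum.elim_inr] at this
  by_cases h1 : (j : ℕ) = i <;> by_cases h2 : (j : ℕ) = i' <;> simp_all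

theorem cayleySum_eq_convexHull (hP : ∀ i, IsLatticePolytope (P i)) :
    cayleySum P = convexHull ℝ (Set.range fun x : Σ i, latticePoints (P i) =>
      cayleyPoint m x.1 (realPoint (P x.1) x.2)) := by
  apply le_antisymm
  · refine convexHull_min (Set.iUnion_subset fun i => ?_) (convex_convexHull ℝ _)
    rintro _ ⟨x, hx, rfl⟩
    have : Fintype (latticePoints (P i)) := (hP i).finite_latticePoints.fintype
    rw [(hP i).eq_convexHull, ← Set.image_univ, mem_convexHull_image_iff] at hx
    obtain ⟨c, hc, -, hc1, rfl⟩ := hx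
    change cayleyPoint m i (∑ a, c a • realPoint (P i) a) ∈ _
    rw [← sum_smul_cayleyPoint _ i hc1]
    exact (convex_convexHull ℝ _).sum_mem (fun a _ => hc a) hc1
      fun a _ => subset_convexHull ℝ _ ⟨⟨i, a⟩, rfl⟩
  · refine convexHull_min ?_ (convex_convexHull ℝ _)
    rintro _ ⟨⟨i, a⟩, rfl⟩
    exact cayleyPoint_mem_cayleySum a.2

theorem IsLatticePolytope.nonempty_latticePoints {ι : Type} {Q : Set (ι → ℝ)}
    (hQ : IsLatticePolytope Q) : (latticePoints Q).Nonempty := by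
  obtain ⟨V, ⟨v, hv⟩, rfl⟩ := hQ
  exact ⟨v, subset_convexHull ℝ _ ⟨v, hv, rfl⟩⟩

theorem isLatticePolytope_cayleySum (hm : 0 < m) (hP : ∀ i, IsLatticePolytope (P i)) :
    IsLatticePolytope (cayleySum P) := by
  classical
  have : ∀ i, Fintype (latticePoints (P i)) := fun i => (hP i).finite_latticePoints.fintype
  obtain ⟨a, ha⟩ := (hP ⟨0, hm⟩).nonempty_latticePoints
  refine ⟨Finset.univ.image fun x : Σ i, latticePoints (P i) => cayleyPoint m x.1 x.2.1,
    ⟨_, Finset.mem_image_of_mem _ (Finset.mem_univ ⟨⟨0, hm⟩, a, ha⟩)⟩, ?_⟩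
  rw [cayleySum_eq_convexHull hP, Finset.coe_image, Finset.coe_univ, Set.image_univ,
    ← Set.range_comp]
  congr 2
  ext x : 1
  exact (toReal_cayleyPoint _ _).symm

/-- The lattice points of the Cayley sum are the lattice points of the summands. -/
theorem exists_eq_cayleyPoint (hP : ∀ i, IsLatticePolytope (P i))
    {z : Fin d ⊕ Fin (m - 1) → ℤ} (hz : z ∈ latticePoints (cayleySum P)) :
    ∃ i, ∃ a ∈ latticePoints (P i), z = cayleyPoint m i a := by
  classical
  have : ∀ i, Fintype (latticePoints (P i)) := fun i => (hP i).finite_latticePoints.fintype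
  rw [latticePoints, Set.mem_ofPred_eq, cayleySum_eq_convexHull hP, ← Set.image_univ,
    mem_convexHull_image_iff] at hz
  obtain ⟨c, hc, -, hc1, hcz⟩ := hz
  -- `Λ i` is the mass on the summand `i`. All masses but the last are integral coordinates of `z`,
  -- so exactly one mass is one and the point lies over a single vertex of the simplex.
  let Λ : Fin m → ℝ := fun i => ∑ a, c ⟨i, a⟩
  have hΛ : ∀ i, 0 ≤ Λ i := fun i => Finset.sum_nonneg fun a _ => hc _
  have hΛ1 : ∑ i, Λ i = 1 := by rw [← hc1, Fintype.sum_sigma]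
  have hΛz : ∀ j : Fin (m - 1), (z (Sum.inr j) : ℝ) = Λ ⟨j, by omega⟩ := fun j => by
    have h1 := congrFun hcz (Sum.inr j)
    simp only [Finset.sum_apply, Pi.smul_apply, cayleyPoint, Sum.elim_inr, smul_eq_mul,
      Fintype.sum_sigma] at h1
    rw [toReal] at h1
    rw [← h1, Finset.sum_eq_single ⟨j, by omega⟩]
    · simp [Λ]
    · intro i _ hi
      exact Finset.sum_eq_zero fun a _ => by
        rw [if_neg fun h => hi (Fin.ext (Eq.symm h)), mul_zero]
    · simp
  obtain ⟨i, hi⟩ : ∃ i, Λ i = 1 := by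
    obtain ⟨i₀, -, hi₀⟩ : ∃ i ∈ Finset.univ, Λ i ≠ 0 := Finset.exists_ne_zero_of_sum_ne_zero
      (by rw [hΛ1]; exact one_ne_zero)
    by_cases hj : ∃ j : Fin (m - 1), z (Sum.inr j) ≠ 0
    · obtain ⟨j, hj⟩ := hj
      refine ⟨⟨j, by omega⟩, ?_⟩
      have h1 : Λ ⟨j, by omega⟩ ≤ 1 :=
        hΛ1 ▸ Finset.single_le_sum (fun i _ => hΛ i) (Finset.mem_univ _)
      have h2 := hΛ ⟨j, by omega⟩
      rw [← hΛz] at h1 h2 ⊢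
      have h3 : z (Sum.inr j) ≤ 1 := by exact_mod_cast h1
      have h4 : 0 ≤ z (Sum.inr j) := by exact_mod_cast h2
      have h5 : z (Sum.inr j) = 1 := by omega
      rw [h5, Int.cast_one]
    · push Not at hj
      have h0 : ∀ i : Fin m, (i : ℕ) < m - 1 → Λ i = 0 := fun i hi => by
        have := hΛz ⟨i, hi⟩
        rw [hj, Int.cast_zero] at this
        exact this.symm
      refine ⟨i₀, ?_⟩
      rw [← hΛ1, eq_comm]
      refine Finset.sum_eq_single i₀ (fun i _ hi => h0 i ?_) (by simp)
      have h1 : ¬ (i₀ : ℕ) < m - 1 := fun h => hi₀ (h0 i₀ h)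
      have h2 : (i : ℕ) ≠ i₀ := fun h => hi (Fin.ext h)
      omega
  have hother : ∀ i' ≠ i, ∀ a, c ⟨i', a⟩ = 0 := by
    intro i' hi' a
    have h1 : ∑ k ∈ Finset.univ.erase i, Λ k = 0 := by
      have := Finset.add_sum_erase Finset.univ Λ (Finset.mem_univ i)
      linarith
    have h2 := (Finset.sum_eq_zero_iff_of_nonneg fun k _ => hΛ k).1 h1 i'
      (Finset.mem_erase.2 ⟨hi', Finset.mem_univ _⟩)
    exact (Finset.sum_eq_zero_iff_of_nonneg fun a _ => hc _).1 h2 a (Finset.mem_univ a)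
  have hz' : toReal z = cayleyPoint m i (∑ a, c ⟨i, a⟩ • realPoint (P i) a) := by
    rw [← sum_smul_cayleyPoint _ i hi, ← hcz, Fintype.sum_sigma, Finset.sum_eq_single i]
    · intro i' _ hi'
      exact Finset.sum_eq_zero fun a _ => by rw [hother i' hi' a, zero_smul]
    · simp
  have hzl : toReal (fun k => z (Sum.inl k)) = ∑ a, c ⟨i, a⟩ • realPoint (P i) a := by
    ext k
    exact congrFun hz' (Sum.inl k)
  refine ⟨i, fun k => z (Sum.inl k), ?_, toReal_injective ?_⟩
  · rw [latticePoints, Set.mem_ofPred_eq, hzl]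
    exact (hP i).convex.sum_mem (fun a _ => hc _) hi fun a _ => a.2
  · rw [toReal_cayleyPoint, hz', hzl]

/-- Each face over a vertex contributes a copy `ψ i` of the full lattice of its summand, and these
copies together span. -/
theorem liftedLattice_cayleySum (hm : 0 < m) (hlat : ∀ i, liftedLattice (P i) = ⊤) :
    liftedLattice (cayleySum P) = ⊤ := by
  let ψ : Fin m → ((Fin d → ℤ) × ℤ) →+ (Fin d ⊕ Fin (m - 1) → ℤ) × ℤ := fun i =>
    { toFun := fun y => (Sum.elim y.1 fun j => if (j : ℕ) = (i : ℕ) then y.2 else 0, y.2)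
      map_zero' := by
        refine Prod.ext (funext fun k => ?_) rfl
        rcases k with k | k <;> simp
      map_add' := fun x y => by
        refine Prod.ext (funext fun k => ?_) rfl
        rcases k with k | k
        · simp
        · by_cases h : (k : ℕ) = (i : ℕ) <;> simp [h] }
  have hψ : ∀ i y, ψ i y ∈ liftedLattice (cayleySum P) := by
    intro i y
    have h1 : liftedLattice (P i) ≤ (liftedLattice (cayleySum P)).comap (ψ i) := by
      rw [liftedLattice, AddSubgroup.closure_le]
      rintro _ ⟨a, ha, rfl⟩
      exact AddSubgroup.subset_closure ⟨_, cayleyPoint_mem_latticePoints ha, rfl⟩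
    rw [hlat] at h1
    exact h1 (AddSubgroup.mem_top y)
  rw [eq_top_iff]
  rintro ⟨z, n⟩ -
  -- The simplex coordinates come from the faces `j < m - 1` with base zero; the last face supplies
  -- the base and the remaining height.
  have hz : (z, n) = ψ ⟨m - 1, by omega⟩ (fun k => z (Sum.inl k), n - ∑ j, z (Sum.inr j)) +
      ∑ j : Fin (m - 1), ψ ⟨j, by omega⟩ (0, z (Sum.inr j)) := by
    refine Prod.ext (funext fun k => ?_) ?_
    · rw [Prod.fst_add, Prod.fst_sum, Pi.add_apply, Finset.sum_apply]
      rcases k with k | k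
      · simp [ψ]
      · have h1 : (k : ℕ) ≠ m - 1 := k.2.ne
        simp [ψ, h1, ← Fin.ext_iff]
    · rw [Prod.snd_add, Prod.snd_sum]
      simp [ψ]
  rw [hz]
  exact add_mem (hψ _ _) (sum_mem fun j _ => hψ _ _)

end Cayley

/-! ### Lattice points and lattice of the Minkowski sum -/

section Minkowski

variable {d m : ℕ} {P : Fin m → Set (Fin d → ℝ)}

theorem toReal_sum {σ ι : Type} (s : Finset σ) (f : σ → ι → ℤ) :
    toReal (∑ i ∈ s, f i) = ∑ i ∈ s, toReal (f i) := by
  ext k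
  simp [toReal]

theorem isLatticePolytope_sum (hP : ∀ i, IsLatticePolytope (P i)) :
    IsLatticePolytope (∑ i, P i) := by
  classical
  choose V hV hPV using hP
  choose v hv using hV
  refine ⟨(Fintype.piFinset V).image fun g => ∑ i, g i,
    ⟨_, Finset.mem_image_of_mem _ (Fintype.mem_piFinset.2 hv)⟩, ?_⟩
  simp only [hPV, ← convexHull_sum]
  congr 1
  ext x
  rw [Set.mem_fintype_sum]
  constructor
  · rintro ⟨g, hg, rfl⟩
    choose f hf hfg using hg
    refine ⟨∑ i, f i, Finset.mem_coe.2 (Finset.mem_image_of_mem _ (Fintype.mem_piFinset.2 hf)), ?_⟩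
    rw [toReal_sum]
    simp only [hfg]
  · rintro ⟨_, hy, rfl⟩
    obtain ⟨f, hf, rfl⟩ := Finset.mem_image.1 (Finset.mem_coe.1 hy)
    exact ⟨fun i => toReal (f i), fun i => ⟨f i, Fintype.mem_piFinset.1 hf i, rfl⟩,
      (toReal_sum _ _).symm⟩

theorem sum_mem_latticePoints_sum {a : Fin m → Fin d → ℤ} (ha : ∀ i, a i ∈ latticePoints (P i)) :
    ∑ i, a i ∈ latticePoints (∑ i, P i) := by
  rw [latticePoints, Set.mem_ofPred_eq, toReal_sum]
  exact Set.mem_fintype_sum _ _ |>.2 ⟨_, ha, rfl⟩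

/-- Fixing lattice points in all summands but one places a translate of that summand's lattice
points inside the sum; at the lifted level, translation is the unimodular shear `θ`. -/
theorem liftedLattice_sum (hm : 0 < m) (hP : ∀ i, IsLatticePolytope (P i))
    (hlat : ∀ i, liftedLattice (P i) = ⊤) : liftedLattice (∑ i, P i) = ⊤ := by
  classical
  choose b hb using fun i => (hP i).nonempty_latticePoints
  let i₀ : Fin m := ⟨0, hm⟩
  let r : Fin d → ℤ := ∑ j ∈ Finset.univ \ {i₀}, b j
  let θ : ((Fin d → ℤ) × ℤ) →+ (Fin d → ℤ) × ℤ :=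
    { toFun := fun y => (y.1 + y.2 • r, y.2)
      map_zero' := by simp
      map_add' := fun x y => by
        refine Prod.ext ?_ rfl
        simp only [Prod.fst_add, Prod.snd_add, add_smul]
        abel }
  have h1 : liftedLattice (P i₀) ≤ (liftedLattice (∑ i, P i)).comap θ := by
    rw [liftedLattice, AddSubgroup.closure_le]
    rintro _ ⟨a, ha, rfl⟩
    refine AddSubgroup.subset_closure ⟨a + r, ?_, by simp [θ]⟩
    have h2 : ∑ j, Function.update b i₀ a j = a + r :=
      Finset.sum_update_of_mem (Finset.mem_univ i₀) b a
    rw [← h2]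
    refine sum_mem_latticePoints_sum fun j => ?_
    by_cases hj : j = i₀
    · subst hj; simpa using ha
    · simpa [hj] using hb j
  rw [hlat] at h1
  rw [eq_top_iff]
  rintro ⟨z, n⟩ -
  have h2 := h1 (AddSubgroup.mem_top (z - n • r, n))
  simpa [θ] using h2

end Minkowski

/-! ### Proof for the Minkowski sum -/

section Main

variable {d m : ℕ} {P : Fin m → Set (Fin d → ℝ)} {ty : latticePoints (cayleySum P) → Fin m}
  {base : latticePoints (cayleySum P) → Fin d → ℤ}

theorem toricExponent_cayleySum (h : ∀ x : latticePoints (cayleySum P), x.1 = cayleyPoint m (ty x) (base x))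
    (u : latticePoints (cayleySum P) →₀ ℕ) :
    toricExponent (cayleySum P) u =
      (Sum.elim (typedMap ty base u).1 fun j : Fin (m - 1) => ((typedMap ty base u).2 ⟨j, by omega⟩ : ℤ),
        ∑ i, (typedMap ty base u).2 i) := by
  classical
  induction u using Finsupp.induction_linear with
  | zero =>
    simp only [map_zero]
    refine Prod.ext (funext fun k => ?_) (by simp)
    rcases k with k | k <;> simp
  | add u v hu hv =>
    rw [map_add, map_add, hu, hv]
    refine Prod.ext (funext fun k => ?_) (by simp [Finset.sum_add_distrib])
    rcases k with k | k <;> simp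
  | single x n =>
    rw [toricExponent_single, typedMap, natCombination_single, h x]
    refine Prod.ext (funext fun k => ?_) (by simp [Pi.single_apply])
    rcases k with k | k
    · simp [cayleyPoint]
    · by_cases hk : (k : ℕ) = ty x
      · simp [cayleyPoint, hk]
      · have : (⟨k, by omega⟩ : Fin m) ≠ ty x := fun h => hk (Fin.ext_iff.1 h)
        simp [cayleyPoint, hk, this]

/-- Counts of the types are determined by the total count and all but the last one. -/
theorem eq_of_forall_eq_of_sum_eq {f g : Fin m → ℕ}
    (h : ∀ j : Fin (m - 1), f ⟨j, by omega⟩ = g ⟨j, by omega⟩) (hs : ∑ i, f i = ∑ i, g i) :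
    f = g := by
  have h1 : ∀ i : Fin m, (i : ℕ) < m - 1 → f i = g i := fun i hi => h ⟨i, hi⟩
  ext i
  by_cases hi : (i : ℕ) < m - 1
  · exact h1 i hi
  · rw [← Finset.add_sum_erase _ f (Finset.mem_univ i),
      ← Finset.add_sum_erase _ g (Finset.mem_univ i), Finset.sum_congr rfl fun j hj => ?_] at hs
    · exact add_right_cancel hs
    · refine h1 j ?_
      have : (j : ℕ) ≠ i := fun h => Finset.ne_of_mem_erase hj (Fin.ext h)
      omega

/-- The last type has no coordinate of its own; its count is the total degree minus the other
counts. -/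
theorem toricExponent_cayleySum_eq_iff
    (h : ∀ x : latticePoints (cayleySum P), x.1 = cayleyPoint m (ty x) (base x))
    (u v : latticePoints (cayleySum P) →₀ ℕ) :
    toricExponent (cayleySum P) u = toricExponent (cayleySum P) v ↔
      typedMap ty base u = typedMap ty base v := by
  rw [toricExponent_cayleySum h, toricExponent_cayleySum h]
  refine ⟨fun huv => ?_, fun huv => by rw [huv]⟩
  have h1 := (Prod.ext_iff.1 huv).1
  refine Prod.ext (funext fun k => congrFun h1 (Sum.inl k))
    (eq_of_forall_eq_of_sum_eq (fun j => ?_) (Prod.ext_iff.1 huv).2)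
  exact Nat.cast_injective (congrFun h1 (Sum.inr j))

/-- Every lattice point of the Minkowski sum is a sum of lattice points of the summands. -/
theorem exists_tuple_sum_eq (hm : 0 < m) (hP : ∀ i, IsLatticePolytope (P i))
    (hlat : ∀ i, liftedLattice (P i) = ⊤) [Fintype (latticePoints (cayleySum P))]
    (h : ∀ x : latticePoints (cayleySum P), x.1 = cayleyPoint m (ty x) (base x))
    {ord : MonomialOrder.{0, 0} (latticePoints (cayleySum P))}
    (H : StandardOfSupport ord (exponentMap (liftedPoint (cayleySum P)))) {b : Fin d → ℤ}
    (hb : b ∈ latticePoints (∑ i, P i)) :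
    ∃ t : Fin m → latticePoints (cayleySum P), (∀ i, ty (t i) = i) ∧ ∑ i, base (t i) = b := by
  obtain ⟨p, hp, hpb⟩ := (Set.mem_fintype_sum P (toReal b)).1 hb
  have hm0 : (m : ℝ) ≠ 0 := by exact_mod_cast hm.ne'
  -- Averaging the `p i` over the `m` vertices of the simplex and scaling by `m` gives `(b, 1, …,
  -- 1)`; the ones force a decomposition with one point of each type.
  have hmem : toReal (Sum.elim b fun _ : Fin (m - 1) => 1) ∈ (m : ℝ) • cayleySum P := by
    refine ⟨∑ i, (1 / m : ℝ) • cayleyPoint m i (p i), ?_, ?_⟩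
    · exact (convex_convexHull ℝ _).sum_mem (fun i _ => by positivity) (by simp [hm0])
        fun i _ => cayleyPoint_mem_cayleySum (hp i)
    · ext k
      rcases k with k | k
      · have := congrFun hpb k
        simp only [Finset.sum_apply] at this
        simp [cayleyPoint, ← Finset.mul_sum, this, toReal, hm0]
      · have h1 : ∑ i : Fin m, (if (k : ℕ) = (i : ℕ) then (1 : ℝ) else 0) = 1 := by
          rw [Finset.sum_eq_single ⟨k, by omega⟩]
          · simp
          · intro i _ hi
            exact if_neg fun h => hi (Fin.ext h.symm)
          · simp
        simp only [cayleyPoint, Pi.smul_apply, Finset.sum_apply, Sum.elim_inr, smul_eq_mul,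
          ← Finset.mul_sum, h1, toReal]
        field_simp
        simp
  obtain ⟨u, hu⟩ := exists_exponentMap_of_mem_smul (isLatticePolytope_cayleySum hm hP)
    (liftedLattice_cayleySum hm hlat) H hmem
  have hu1 : ∀ k, (toricExponent (cayleySum P) u).1 k = Sum.elim b (fun _ => 1) k := fun k => by
    rw [toricExponent_fst, hu]; rfl
  have hu2 : (toricExponent (cayleySum P) u).2 = m := by
    have : ((toricExponent (cayleySum P) u).2 : ℤ) = m := by rw [toricExponent_snd, hu]; rfl
    exact_mod_cast this
  rw [toricExponent_cayleySum h] at hu1 hu2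
  have hu3 : typedMap ty base u = (b, fun _ => 1) := by
    refine Prod.ext (funext fun k => hu1 (Sum.inl k))
      (eq_of_forall_eq_of_sum_eq (fun j => ?_) (by simpa using hu2))
    exact Nat.cast_injective (hu1 (Sum.inr j))
  obtain ⟨t, ht, rfl⟩ := exists_eq_tuple hu3
  rw [typedMap_tuple ht] at hu3
  exact ⟨t, ht, congrArg Prod.fst hu3⟩

/-- An initial ideal generated in degree at most one vanishes. -/
theorem IsSquarefreeFibration.isStandard_of_le_one {ι : Type} {Q : Set (ι → ℝ)}
    {ord : MonomialOrder.{0, 0} (latticePoints Q)} {l : ℕ}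
    (hS : IsSquarefreeFibration ord (toricExponent Q) l) (hl : l ≤ 1)
    (u : latticePoints Q →₀ ℕ) : IsStandard ord (toricExponent Q) u := by
  classical
  obtain ⟨S, hSl, hS⟩ := hS
  by_contra hu
  obtain ⟨s, hs, -⟩ := (hS u).1 hu
  have hns : ¬ IsStandard ord (toricExponent Q) s := (hS s).2 ⟨s, hs, le_rfl⟩
  have hdeg : ∀ v : latticePoints Q →₀ ℕ, (toricExponent Q v).2 = v.degree := fun v => by
    induction v using Finsupp.induction_linear with
    | zero => simp
    | add u v hu hv => rw [map_add, Prod.snd_add, hu, hv, map_add]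
    | single a n => simp [toricExponent_single]
  obtain ⟨v, hv, hlt⟩ := exists_lt_of_not_isStandard hns
  have hvs : v.degree = s.degree := by rw [← hdeg, ← hdeg, hv]
  have hs1 := (hSl s hs).2
  -- The zero vector is standard, and a degree one fibre is a single variable, so neither can be a
  -- generator.
  rcases Nat.lt_or_ge s.degree 1 with h0 | h1
  · have : s = 0 := by rw [← Finsupp.degree_eq_zero_iff]; omega
    exact hns (this ▸ isStandard_zero)
  · obtain ⟨x, rfl⟩ := (Finsupp.sum_eq_one_iff s).1 (by
      change s.degree = 1; omega)
    obtain ⟨y, rfl⟩ := (Finsupp.sum_eq_one_iff v).1 (by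
      change v.degree = 1; omega)
    simp only [toricExponent_single, one_smul, Prod.mk.injEq, and_true] at hv
    rw [Subtype.ext hv] at hlt
    exact lt_irrefl _ hlt

/-- If the toric ideal of the Cayley sum of at least two summands vanishes, every summand has only
one lattice point. -/
theorem eq_of_type_eq (hm : 2 ≤ m) (hP : ∀ i, IsLatticePolytope (P i))
    (hlat : ∀ i, liftedLattice (P i) = ⊤) [Fintype (latticePoints (cayleySum P))]
    (h : ∀ x : latticePoints (cayleySum P), x.1 = cayleyPoint m (ty x) (base x))
    {ord : MonomialOrder.{0, 0} (latticePoints (cayleySum P))}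
    (hst : ∀ u, IsStandard ord (exponentMap (liftedPoint (cayleySum P))) u)
    {x y : latticePoints (cayleySum P)} (hxy : ty x = ty y) : x = y := by
  classical
  by_contra hne
  have : Nontrivial (Fin m) := Fin.nontrivial_iff_two_le.2 hm
  obtain ⟨j, hj⟩ := exists_ne (ty x)
  have : Fintype (latticePoints (P j)) := (hP j).finite_latticePoints.fintype
  -- The difference of the two points is an integral combination, of total height zero, of lattice
  -- points of another summand. This is a linear relation in the Cayley sum in which `x` has
  -- coefficient one.
  obtain ⟨n, hn⟩ := exists_sum_mul_liftedPoint (hlat j) fun o => o.elim 0 (base x - base y)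
  let e : latticePoints (P j) → latticePoints (cayleySum P) := fun a =>
    ⟨cayleyPoint m j a, cayleyPoint_mem_latticePoints a.2⟩
  have he : ∀ a, e a ≠ x := fun a hax => by
    have h1 : cayleyPoint m j (a : Fin d → ℤ) = cayleyPoint m (ty x) (base x) := by
      rw [← h x, ← hax]
    exact hj (cayleyPoint_injective h1).1
  let c : latticePoints (cayleySum P) → ℝ := fun z =>
    (if z = x then 1 else 0) - (if z = y then 1 else 0) - ∑ a, if z = e a then (n a : ℝ) else 0
  have hn' : ∀ k, ∑ a, (n a : ℝ) * liftedPoint (P j) a k =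
      ((k.elim 0 (base x - base y) : ℤ) : ℝ) := fun k => by exact_mod_cast hn k
  have hc : ∀ k, ∑ z, c z * liftedPoint (cayleySum P) z k = 0 := by
    intro k
    have h1 : ∑ z, c z * liftedPoint (cayleySum P) z k = liftedPoint (cayleySum P) x k -
        liftedPoint (cayleySum P) y k - ∑ a, (n a : ℝ) * liftedPoint (cayleySum P) (e a) k := by
      simp only [c, sub_mul, Finset.sum_sub_distrib, Finset.sum_mul]
      rw [Finset.sum_comm]
      simp
    have h0 := hn' none
    simp only [liftedPoint, Option.elim_none, Int.cast_one, mul_one, Int.cast_zero] at h0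
    rw [h1]
    rcases k with _ | k | k
    · simpa [liftedPoint] using h0
    · have h2 := hn' (some k)
      simp only [liftedPoint, Option.elim_some] at h2
      simp only [liftedPoint, Option.elim_some, h x, h y, e, cayleyPoint, Sum.elim_inl, h2]
      push_cast [Pi.sub_apply]
      ring
    · simp only [liftedPoint, Option.elim_some, h x, h y, e, cayleyPoint, Sum.elim_inr, hxy,
        ← Finset.sum_mul, h0]
      ring
  -- The all-ones vector is standard with full support, so all lifted points are independent.
  have h2 : c x = 0 := eq_zero_of_sum_mul_eq_zero (fun _ v _ _ => hst v)
    (hst (Finsupp.equivFunOnFinite.symm fun _ => 1)) (fun a ha => absurd ha (by simp)) hc x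
  simp [c, hne, fun a => (he a).symm] at h2

end Main

/-- The Minkowski sum inherits a squarefree initial ideal from the Cayley sum. -/
theorem hasSquarefreeInitialIdeal_sum {K : Type*} [Field K] {d m : ℕ} (hm : 2 ≤ m)
    {P : Fin m → Set (Fin d → ℝ)} (hP : ∀ i, IsLatticePolytope (P i))
    (hlat : ∀ i, liftedLattice (P i) = ⊤) {l : ℕ}
    (hC : HasSquarefreeInitialIdeal (toricIdeal K (cayleySum P)) l) :
    HasSquarefreeInitialIdeal (toricIdeal K (∑ i, P i)) l := by
  have hm0 : 0 < m := by omega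
  have : Fintype (latticePoints (cayleySum P)) :=
    (isLatticePolytope_cayleySum hm0 hP).finite_latticePoints.fintype
  have : Fintype (latticePoints (∑ i, P i)) :=
    (isLatticePolytope_sum hP).finite_latticePoints.fintype
  obtain ⟨ord, hord⟩ := (hasSquarefreeInitialIdeal_toricIdeal_iff _ l).1 hC
  choose ty base hbase h using fun x : latticePoints (cayleySum P) => exists_eq_cayleyPoint hP x.2
  have H := (hord.congr (toricExponent_eq_iff _)).standardOfSupport
  obtain ⟨c, hc⟩ := exists_isStandardDecomposition (ty := ty) (val := base)
    (valB := fun b : latticePoints (∑ i, P i) => (b : Fin d → ℤ)) ord Subtype.val_injective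
    (fun b => exists_tuple_sum_eq hm0 hP hlat h H b.2)
    (fun t ht => ⟨⟨_, sum_mem_latticePoints_sum fun i => by
      have := hbase (t i)
      rwa [ht] at this⟩, rfl⟩)
  obtain ⟨ord₀⟩ := nonempty_monomialOrder (latticePoints (∑ i, P i))
  refine (hasSquarefreeInitialIdeal_toricIdeal_iff _ l).2 ⟨_, hc.isSquarefreeFibration ord₀ hm0
    (idx := fun x => Fintype.equivFin _ x) (Fin.val_injective.comp (Equiv.injective _))
    (hord.congr (toricExponent_cayleySum_eq_iff h)) ?_⟩
  -- Incomparable pairs need degree two; below that bound each type has only one point, so there are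
  -- none.
  rcases Nat.lt_or_ge l 2 with hl | hl
  · refine Or.inr fun x y hxy => eq_of_type_eq hm hP hlat h (ord := ord) (fun u => ?_) hxy
    rw [← isStandard_congr (toricExponent_eq_iff _)]
    exact hord.isStandard_of_le_one (by omega) u
  · exact Or.inl hl

end CayleyMinkowski

theorem theorem1p2 {K : Type*} [Field K] {d m : ℕ} (hm : 2 ≤ m)
    (P : Fin m → Set (Fin d → ℝ))
    (hP : ∀ i, CayleyMinkowski.IsLatticePolytope (P i))
    (hdim : ∀ i, CayleyMinkowski.dim (P i) = d)
    (hlat : ∀ i, CayleyMinkowski.liftedLattice (P i) = ⊤)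
    (l : ℕ)
    (hCayley : CayleyMinkowski.HasSquarefreeInitialIdeal
      (CayleyMinkowski.toricIdeal K (CayleyMinkowski.cayleySum P)) l) :
    CayleyMinkowski.HasSquarefreeInitialIdeal
        (CayleyMinkowski.toricIdeal K (∑ i, P i)) l ∧
      (CayleyMinkowski.HasRegularUnimodularTriangulation (CayleyMinkowski.cayleySum P) ∧
        CayleyMinkowski.IsIDP (CayleyMinkowski.cayleySum P)) ∧
      (CayleyMinkowski.HasRegularUnimodularTriangulation (∑ i, P i) ∧
        CayleyMinkowski.IsIDP (∑ i, P i)) := by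
  have hm0 : 0 < m := by omega
  have hsum := CayleyMinkowski.hasSquarefreeInitialIdeal_sum hm hP hlat hCayley
  exact ⟨hsum,
    CayleyMinkowski.regularUnimodularTriangulation_and_isIDP
      (CayleyMinkowski.isLatticePolytope_cayleySum hm0 hP)
      (CayleyMinkowski.liftedLattice_cayleySum hm0 hlat) hCayley,
    CayleyMinkowski.regularUnimodularTriangulation_and_isIDP
      (CayleyMinkowski.isLatticePolytope_sum hP)
      (CayleyMinkowski.liftedLattice_sum hm0 hP hlat) hsum⟩
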